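/- All graphs are finite, undirected and without loops or multiple edges. For a graph $H$, a set $D\subseteq V(H)$ is dominating if every vertex of $H$ lies in $D$ or has a neighbour in $D$. Let $\gamma(H)$ be the minimum cardinality of a dominating set of $H$, and let $i(H)$ be the minimum cardinality of a maximal independent set of $H$ (equivalently, of an independent dominating set). A graph $G$ is domination perfect if $\gamma(H)=i(H)$ for every induced subgraph $H$ of $G$. Theorem. A graph $G$ is domination perfect if and only if $G$ contains none of the following $17$ graphs $G_1,\dots,G_{17}$ as an induced subgraph (up to isomorphism). Here $G_j$ has vertex set $\{0,1,\dots,n-1\}$, and $a\text{-}b$ denotes an edge joining $a$ and $b$. - $G_{1}$: $n=6$, edges $0\text{-}1,\ 1\text{-}2,\ 1\text{-}4,\ 3\text{-}4,\ 4\text{-}5$. - $G_{2}$: $n=6$, edges $0\text{-}1,\ 0\text{-}3,\ 1\text{-}2,\ 1\text{-}4,\ 3\text{-}4,\ 4\text{-}5$. - $G_{3}$: $n=6$, edges $0\text{-}1,\ 0\text{-}3,\ 0\text{-}5,\ 1\text{-}2,\ 1\text{-}4,\ 3\text{-}4,\ 4\text{-}5$. - $G_{4}$: $n=6$, edges $0\text{-}1,\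 0\text{-}3,\ 0\text{-}5,\ 1\text{-}2,\ 1\text{-}4,\ 2\text{-}3,\ 2\text{-}5,\ 3\text{-}4,\ 4\text{-}5$. - $G_{5}$: $n=7$, edges $0\text{-}1,\ 0\text{-}4,\ 1\text{-}2,\ 1\text{-}3,\ 1\text{-}5,\ 2\text{-}6,\ 3\text{-}5,\ 4\text{-}5,\ 5\text{-}6$. - $G_{6}$: $n=7$, edges $0\text{-}1,\ 0\text{-}3,\ 0\text{-}4,\ 0\text{-}6,\ 1\text{-}2,\ 1\text{-}3,\ 1\text{-}5,\ 2\text{-}6,\ 3\text{-}5,\ 3\text{-}6,\ 4\text{-}5,\ 5\text{-}6$. - $G_{7}$: $n=8$, edges $0\text{-}1,\ 0\text{-}5,\ 1\text{-}2,\ 1\text{-}3,\ 1\text{-}4,\ 1\text{-}6,\ 2\text{-}3,\ 2\text{-}7,\ 3\text{-}6,\ 4\text{-}6,\ 4\text{-}7,\ 5\text{-}6,\ 6\text{-}7$. - $G_{8}$: $n=8$, edges $0\text{-}1,\ 0\text{-}5,\ 1\text{-}2,\ 1\text{-}3,\ 1\text{-}4,\ 1\text{-}6,\ 2\text{-}7,\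 3\text{-}5,\ 3\text{-}6,\ 4\text{-}6,\ 4\text{-}7,\ 5\text{-}6,\ 6\text{-}7$. - $G_{9}$: $n=8$, edges $0\text{-}1,\ 0\text{-}5,\ 1\text{-}2,\ 1\text{-}3,\ 1\text{-}4,\ 1\text{-}6,\ 2\text{-}3,\ 2\text{-}7,\ 3\text{-}5,\ 3\text{-}6,\ 4\text{-}6,\ 4\text{-}7,\ 5\text{-}6,\ 6\text{-}7$. - $G_{10}$: $n=8$, edges $0\text{-}1,\ 0\text{-}5,\ 1\text{-}2,\ 1\text{-}3,\ 1\text{-}4,\ 1\text{-}6,\ 2\text{-}3,\ 2\text{-}7,\ 3\text{-}4,\ 3\text{-}6,\ 4\text{-}6,\ 4\text{-}7,\ 5\text{-}6,\ 6\text{-}7$. - $G_{11}$: $n=8$, edges $0\text{-}1,\ 0\text{-}5,\ 1\text{-}2,\ 1\text{-}3,\ 1\text{-}4,\ 1\text{-}6,\ 2\text{-}7,\ 3\text{-}4,\ 3\text{-}5,\ 3\text{-}6,\ 4\text{-}6,\ 4\text{-}7,\ 5\text{-}6,\ 6\text{-}7$. - $G_{12}$: $n=8$, edges $0\text{-}1,\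 0\text{-}5,\ 1\text{-}2,\ 1\text{-}3,\ 1\text{-}4,\ 1\text{-}6,\ 2\text{-}3,\ 2\text{-}7,\ 3\text{-}4,\ 3\text{-}5,\ 3\text{-}6,\ 4\text{-}6,\ 4\text{-}7,\ 5\text{-}6,\ 6\text{-}7$. - $G_{13}$: $n=8$, edges $0\text{-}1,\ 0\text{-}4,\ 0\text{-}5,\ 1\text{-}2,\ 1\text{-}3,\ 1\text{-}4,\ 1\text{-}6,\ 2\text{-}3,\ 2\text{-}7,\ 3\text{-}4,\ 3\text{-}5,\ 3\text{-}6,\ 4\text{-}6,\ 4\text{-}7,\ 5\text{-}6,\ 6\text{-}7$. - $G_{14}$: $n=9$, edges $0\text{-}2,\ 0\text{-}3,\ 0\text{-}6,\ 0\text{-}7,\ 1\text{-}2,\ 1\text{-}5,\ 1\text{-}6,\ 2\text{-}3,\ 2\text{-}4,\ 2\text{-}5,\ 2\text{-}7,\ 3\text{-}4,\ 3\text{-}8,\ 4\text{-}6,\ 4\text{-}7,\ 5\text{-}7,\ 5\text{-}8,\ 6\text{-}7,\ 7\text{-}8$. - $G_{15}$: $n=9$, edges $0\text{-}1,\ 0\text{-}2,\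 0\text{-}6,\ 0\text{-}7,\ 1\text{-}2,\ 1\text{-}5,\ 1\text{-}6,\ 2\text{-}3,\ 2\text{-}4,\ 2\text{-}5,\ 2\text{-}7,\ 3\text{-}4,\ 3\text{-}8,\ 4\text{-}6,\ 4\text{-}7,\ 5\text{-}7,\ 5\text{-}8,\ 6\text{-}7,\ 7\text{-}8$. - $G_{16}$: $n=9$, edges $0\text{-}1,\ 0\text{-}2,\ 0\text{-}3,\ 0\text{-}6,\ 0\text{-}7,\ 0\text{-}8,\ 1\text{-}2,\ 1\text{-}5,\ 1\text{-}6,\ 2\text{-}3,\ 2\text{-}4,\ 2\text{-}5,\ 2\text{-}7,\ 3\text{-}4,\ 3\text{-}8,\ 4\text{-}6,\ 4\text{-}7,\ 5\text{-}7,\ 5\text{-}8,\ 6\text{-}7,\ 7\text{-}8$. - $G_{17}$: $n=11$, edges $0\text{-}1,\ 0\text{-}2,\ 0\text{-}3,\ 0\text{-}4,\ 0\text{-}5,\ 0\text{-}8,\ 1\text{-}2,\ 1\text{-}5,\ 1\text{-}6,\ 1\text{-}9,\ 2\text{-}3,\ 2\text{-}4,\ 2\text{-}5,\ 2\text{-}7,\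 2\text{-}9,\ 2\text{-}10,\ 3\text{-}4,\ 3\text{-}8,\ 3\text{-}9,\ 3\text{-}10,\ 4\text{-}6,\ 4\text{-}7,\ 5\text{-}7,\ 5\text{-}8,\ 5\text{-}10,\ 6\text{-}7,\ 6\text{-}9,\ 7\text{-}8,\ 7\text{-}10,\ 8\text{-}10,\ 9\text{-}10$. -/

import Mathlib

namespace DomPerfect

variable {V : Type*}

/-- `D` is a dominating set of `G`: every vertex lies in `D` or has a neighbour in `D`. -/
def IsDominating (G : SimpleGraph V) (D : Finset V) : Prop :=
  ∀ x : V, x ∈ D ∨ ∃ y ∈ D, G.Adj y x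

/-- The domination number `γ(G)`: the minimum cardinality of a dominating set. For finite `V` the
set of cardinalities is nonempty, so the infimum is attained. -/
noncomputable def dominationNumber (G : SimpleGraph V) : ℕ :=
  sInf {n | ∃ D : Finset V, IsDominating G D ∧ D.card = n}

/-- The independent domination number `i(G)`: the minimum cardinality of a maximal independent set.
For finite `V` a maximal independent set exists, so the infimum is attained. -/
noncomputable def independentDominationNumber (G : SimpleGraph V) : ℕ :=
  sInf {n | ∃ D : Finset V, Maximal (fun S : Finset V => G.IsIndepSet (S : Set V)) D ∧ D.card = n}

/-- `G` is domination perfect: `γ(H) = i(H)` for every induced subgraph `H` of `G`. -/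
def IsDominationPerfect (G : SimpleGraph V) : Prop :=
  ∀ S : Set V, dominationNumber (G.induce S) = independentDominationNumber (G.induce S)

/-- The simple graph on `{0, …, n - 1}` with the listed edges. -/
def graphOfEdges (n : ℕ) (l : List (Fin n × Fin n)) : SimpleGraph (Fin n) :=
  SimpleGraph.fromRel (fun a b => (a, b) ∈ l)

/-! The seventeen graphs `G_1, …, G_17`, given by their edge lists. The numbering of the vertices is
row by row, from top to bottom and left to right, in the usual drawings. -/

/-- The graph `G_{1}`. -/
def G1 : SimpleGraph (Fin 6) :=
  graphOfEdges 6
    [(0, 1), (1, 2), (1, 4), (3, 4), (4, 5)]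

/-- The graph `G_{2}`. -/
def G2 : SimpleGraph (Fin 6) :=
  graphOfEdges 6
    [(0, 1), (0, 3), (1, 2), (1, 4), (3, 4), (4, 5)]

/-- The graph `G_{3}`. -/
def G3 : SimpleGraph (Fin 6) :=
  graphOfEdges 6
    [(0, 1), (0, 3), (0, 5), (1, 2), (1, 4), (3, 4), (4, 5)]

/-- The graph `G_{4}`. -/
def G4 : SimpleGraph (Fin 6) :=
  graphOfEdges 6
    [(0, 1), (0, 3), (0, 5), (1, 2), (1, 4), (2, 3), (2, 5), (3, 4), (4, 5)]

/-- The graph `G_{5}`. -/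
def G5 : SimpleGraph (Fin 7) :=
  graphOfEdges 7
    [(0, 1), (0, 4), (1, 2), (1, 3), (1, 5), (2, 6), (3, 5), (4, 5), (5, 6)]

/-- The graph `G_{6}`. -/
def G6 : SimpleGraph (Fin 7) :=
  graphOfEdges 7
    [(0, 1), (0, 3), (0, 4), (0, 6), (1, 2), (1, 3), (1, 5), (2, 6), (3, 5), (3, 6),
     (4, 5), (5, 6)]

/-- The graph `G_{7}`. -/
def G7 : SimpleGraph (Fin 8) :=
  graphOfEdges 8
    [(0, 1), (0, 5), (1, 2), (1, 3), (1, 4), (1, 6), (2, 3), (2, 7), (3, 6), (4, 6),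
     (4, 7), (5, 6), (6, 7)]

/-- The graph `G_{8}`. -/
def G8 : SimpleGraph (Fin 8) :=
  graphOfEdges 8
    [(0, 1), (0, 5), (1, 2), (1, 3), (1, 4), (1, 6), (2, 7), (3, 5), (3, 6), (4, 6),
     (4, 7), (5, 6), (6, 7)]

/-- The graph `G_{9}`. -/
def G9 : SimpleGraph (Fin 8) :=
  graphOfEdges 8
    [(0, 1), (0, 5), (1, 2), (1, 3), (1, 4), (1, 6), (2, 3), (2, 7), (3, 5), (3, 6),
     (4, 6), (4, 7), (5, 6), (6, 7)]

/-- The graph `G_{10}`. -/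
def G10 : SimpleGraph (Fin 8) :=
  graphOfEdges 8
    [(0, 1), (0, 5), (1, 2), (1, 3), (1, 4), (1, 6), (2, 3), (2, 7), (3, 4), (3, 6),
     (4, 6), (4, 7), (5, 6), (6, 7)]

/-- The graph `G_{11}`. -/
def G11 : SimpleGraph (Fin 8) :=
  graphOfEdges 8
    [(0, 1), (0, 5), (1, 2), (1, 3), (1, 4), (1, 6), (2, 7), (3, 4), (3, 5), (3, 6),
     (4, 6), (4, 7), (5, 6), (6, 7)]

/-- The graph `G_{12}`. -/
def G12 : SimpleGraph (Fin 8) :=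
  graphOfEdges 8
    [(0, 1), (0, 5), (1, 2), (1, 3), (1, 4), (1, 6), (2, 3), (2, 7), (3, 4), (3, 5),
     (3, 6), (4, 6), (4, 7), (5, 6), (6, 7)]

/-- The graph `G_{13}`. -/
def G13 : SimpleGraph (Fin 8) :=
  graphOfEdges 8
    [(0, 1), (0, 4), (0, 5), (1, 2), (1, 3), (1, 4), (1, 6), (2, 3), (2, 7), (3, 4),
     (3, 5), (3, 6), (4, 6), (4, 7), (5, 6), (6, 7)]

/-- The graph `G_{14}`. -/
def G14 : SimpleGraph (Fin 9) :=
  graphOfEdges 9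
    [(0, 2), (0, 3), (0, 6), (0, 7), (1, 2), (1, 5), (1, 6), (2, 3), (2, 4), (2, 5),
     (2, 7), (3, 4), (3, 8), (4, 6), (4, 7), (5, 7), (5, 8), (6, 7), (7, 8)]

/-- The graph `G_{15}`. -/
def G15 : SimpleGraph (Fin 9) :=
  graphOfEdges 9
    [(0, 1), (0, 2), (0, 6), (0, 7), (1, 2), (1, 5), (1, 6), (2, 3), (2, 4), (2, 5),
     (2, 7), (3, 4), (3, 8), (4, 6), (4, 7), (5, 7), (5, 8), (6, 7), (7, 8)]

/-- The graph `G_{16}`. -/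
def G16 : SimpleGraph (Fin 9) :=
  graphOfEdges 9
    [(0, 1), (0, 2), (0, 3), (0, 6), (0, 7), (0, 8), (1, 2), (1, 5), (1, 6), (2, 3),
     (2, 4), (2, 5), (2, 7), (3, 4), (3, 8), (4, 6), (4, 7), (5, 7), (5, 8), (6, 7),
     (7, 8)]

/-- The graph `G_{17}`. -/
def G17 : SimpleGraph (Fin 11) :=
  graphOfEdges 11
    [(0, 1), (0, 2), (0, 3), (0, 4), (0, 5), (0, 8), (1, 2), (1, 5), (1, 6), (1, 9),
     (2, 3), (2, 4), (2, 5), (2, 7), (2, 9), (2, 10), (3, 4), (3, 8), (3, 9), (3, 10),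
     (4, 6), (4, 7), (5, 7), (5, 8), (5, 10), (6, 7), (6, 9), (7, 8), (7, 10), (8, 10),
     (9, 10)]

/-- The family of the seventeen graphs, each with its number of vertices; `forbidden j` is the graph
numbered `j + 1` above. -/
def forbidden : Fin 17 → Σ n : ℕ, SimpleGraph (Fin n) :=
  ![⟨6, G1⟩, ⟨6, G2⟩, ⟨6, G3⟩, ⟨6, G4⟩, ⟨7, G5⟩, ⟨7, G6⟩,
    ⟨8, G7⟩, ⟨8, G8⟩, ⟨8, G9⟩, ⟨8, G10⟩, ⟨8, G11⟩, ⟨8, G12⟩,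
    ⟨8, G13⟩, ⟨9, G14⟩, ⟨9, G15⟩, ⟨9, G16⟩, ⟨11, G17⟩]

/-!
Call an edge dominating if its two ends dominate the whole graph, and consider graphs which have a
dominating edge but which no independent set of at most two vertices dominates. Each of the
seventeen graphs is of this kind, hence has `γ = 2 < i`, and so does not embed in a domination
perfect graph. Conversely, if `γ ≠ i`, take a minimum dominating set spanning as few edges as
possible. It spans some edge `uv`. In the graph induced on `u`, `v` and the vertices that only `u`
and `v` dominate, `uv` is a dominating edge; an independent pair dominating this graph could replace
`u` and `v` and would reduce the number of spanned edges.

It remains to find one of the seventeen graphs in a graph of this kind. With respect to a dominating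
edge `uv` each vertex is a private neighbour of `u`, a private neighbour of `v`, or a common
neighbour. If the graph contains none of `G₁`, `G₂`, `G₃`, `G₄`, `G₆`, two nonadjacent private
neighbours of `u` split the private neighbours of `v` between them, which produces an induced domino
through `uv`. From there on, any two nonadjacent vertices of the configuration are both missed by
some further vertex. The excluded graphs determine how the new vertex attaches to the configuration,
until it can no longer attach in any way.
-/

/-- Two adjacent vertices that together dominate the whole graph. As `u` and `v` are adjacent, every
vertex has a neighbour among them. -/
def IsDominatingEdge (G : SimpleGraph V) (u v : V) : Prop :=
  G.Adj u v ∧ ∀ w, G.Adj u w ∨ G.Adj v w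

/-- No independent set of one or two vertices dominates the graph; the case `x = y` covers single
vertices, and `Gᶜ.Adj x w` says that `w` is neither `x` nor a neighbour of `x`. -/
def NoIndepDominatingPair (G : SimpleGraph V) : Prop :=
  ∀ x y, ¬ G.Adj x y → ∃ w, Gᶜ.Adj x w ∧ Gᶜ.Adj y w

variable {W : Type*} {G : SimpleGraph V} {H : SimpleGraph W} {D : Finset V} {u v : V}

theorem IsDominatingEdge.map (e : G ≃g H) (h : IsDominatingEdge G u v) :
    IsDominatingEdge H (e u) (e v) := by
  refine ⟨e.map_adj_iff.2 h.1, fun w => ?_⟩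
  obtain ⟨w, rfl⟩ := e.surjective w
  simpa only [e.map_adj_iff] using h.2 w

theorem NoIndepDominatingPair.map (e : G ≃g H) (h : NoIndepDominatingPair G) :
    NoIndepDominatingPair H := by
  intro x y hxy
  obtain ⟨x, rfl⟩ := e.surjective x
  obtain ⟨y, rfl⟩ := e.surjective y
  obtain ⟨w, hw⟩ := h x y (by rwa [e.map_adj_iff] at hxy)
  exact ⟨e w, by simpa [e.map_adj_iff] using hw⟩

theorem dominationNumber_le (hD : IsDominating G D) : dominationNumber G ≤ D.card :=
  Nat.sInf_le ⟨D, hD, rfl⟩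

theorem independentDominationNumber_le
    (hD : Maximal (fun S : Finset V => G.IsIndepSet (S : Set V)) D) :
    independentDominationNumber G ≤ D.card :=
  Nat.sInf_le ⟨D, hD, rfl⟩

theorem maximal_isIndepSet_iff :
    Maximal (fun S : Finset V => G.IsIndepSet (S : Set V)) D ↔
      G.IsIndepSet (D : Set V) ∧ IsDominating G D := by
  classical
  constructor
  · intro h
    refine ⟨h.prop, fun x => ?_⟩
    by_contra! hx
    refine hx.1 (h.le_of_ge (y := insert x D) ?_ (Finset.subset_insert x D)
      (Finset.mem_insert_self x D))
    rw [Finset.coe_insert]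
    exact h.prop.insert fun y hy _ => ⟨fun hxy => hx.2 y hy hxy.symm, hx.2 y hy⟩
  · rintro ⟨hind, hdom⟩
    refine ⟨hind, fun E hE hDE x hx => ?_⟩
    rcases hdom x with hxD | ⟨y, hy, hyx⟩
    · exact hxD
    · exact absurd hyx (hE (hDE hy) hx hyx.ne)

theorem IsDominatingEdge.dominationNumber_le_two (h : IsDominatingEdge G u v) :
    dominationNumber G ≤ 2 := by
  classical
  refine (dominationNumber_le (D := {u, v}) fun x => Or.inr ?_).trans Finset.card_le_two
  simpa using h.2 x

theorem exists_isDominating_card [Finite V] (G : SimpleGraph V) :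
    ∃ D : Finset V, IsDominating G D ∧ D.card = dominationNumber G := by
  have := Fintype.ofFinite V
  exact Nat.sInf_mem (s := {n | ∃ D : Finset V, IsDominating G D ∧ D.card = n})
    ⟨_, Finset.univ, fun x => Or.inl (Finset.mem_univ x), rfl⟩

theorem exists_maximal_isIndepSet_card [Finite V] (G : SimpleGraph V) :
    ∃ D : Finset V, Maximal (fun S : Finset V => G.IsIndepSet (S : Set V)) D ∧
      D.card = independentDominationNumber G := by
  obtain ⟨D, hD⟩ := (Set.toFinite {S : Finset V | G.IsIndepSet (S : Set V)}).exists_maximal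
    ⟨∅, by simp⟩
  exact Nat.sInf_mem
    (s := {n | ∃ D : Finset V, Maximal (fun S : Finset V => G.IsIndepSet (S : Set V)) D ∧
      D.card = n}) ⟨_, D, hD, rfl⟩

theorem dominationNumber_le_independentDominationNumber [Finite V] (G : SimpleGraph V) :
    dominationNumber G ≤ independentDominationNumber G := by
  obtain ⟨D, hD, hcard⟩ := exists_maximal_isIndepSet_card G
  exact hcard ▸ dominationNumber_le (maximal_isIndepSet_iff.1 hD).2

theorem IsDominating.nonempty [Nonempty V] (hD : IsDominating G D) : D.Nonempty := by
  obtain ⟨x⟩ := ‹Nonempty V›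
  rcases hD x with hx | ⟨y, hy, -⟩
  exacts [⟨x, hx⟩, ⟨y, hy⟩]

theorem NoIndepDominatingPair.two_lt_card [Nonempty V] (h : NoIndepDominatingPair G)
    (hind : G.IsIndepSet (D : Set V)) (hdom : IsDominating G D) : 2 < D.card := by
  classical
  by_contra! hle
  obtain ⟨x, y, rfl⟩ : ∃ x y, D = {x, y} := by
    have hpos := hdom.nonempty.card_pos
    interval_cases hc : D.card
    · obtain ⟨x, rfl⟩ := Finset.card_eq_one.1 hc
      exact ⟨x, x, by simp⟩
    · obtain ⟨x, y, -, rfl⟩ := Finset.card_eq_two.1 hc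
      exact ⟨x, y, rfl⟩
  obtain ⟨w, hxw, hyw⟩ := h x y fun hadj => hind (by simp) (by simp) hadj.ne hadj
  rw [SimpleGraph.compl_adj] at hxw hyw
  have := hdom w
  grind

theorem NoIndepDominatingPair.two_lt_independentDominationNumber [Finite V] [Nonempty V]
    (h : NoIndepDominatingPair G) : 2 < independentDominationNumber G := by
  obtain ⟨D, hD, hcard⟩ := exists_maximal_isIndepSet_card G
  obtain ⟨hind, hdom⟩ := maximal_isIndepSet_iff.1 hD
  exact hcard ▸ h.two_lt_card hind hdom

theorem IsDominationPerfect.not_isDominatingEdge [Finite V] (hG : IsDominationPerfect G)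
    (hHG : H.IsIndContained G) (hH : NoIndepDominatingPair H) (u v : W) :
    ¬ IsDominatingEdge H u v := by
  intro huv
  obtain ⟨φ⟩ := hHG
  let e : H ≃g G.induce (Set.range φ) :=
    ⟨Equiv.ofInjective φ φ.injective, fun {a b} => φ.map_adj_iff⟩
  have : Nonempty (Set.range φ) := ⟨e u⟩
  have hle := (huv.map e).dominationNumber_le_two
  have hlt := (hH.map e).two_lt_independentDominationNumber
  have heq := hG (Set.range φ)
  omega

/-- The vertices that are dominated by no vertex of `D` other than `u` and `v`, together with
`u` and `v`: the vertices that any replacement of `u` and `v` in `D` has to dominate. -/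
def residue (G : SimpleGraph V) (D : Finset V) (u v : V) : Set V :=
  {x | x = u ∨ x = v ∨ x ∉ D ∧ ∀ d ∈ D, d ≠ u → d ≠ v → ¬ G.Adj d x}

theorem IsDominating.isDominatingEdge_residue (hD : IsDominating G D) (huv : G.Adj u v) :
    IsDominatingEdge (G.induce (residue G D u v)) ⟨u, Or.inl rfl⟩ ⟨v, Or.inr (Or.inl rfl)⟩ := by
  refine ⟨huv, ?_⟩
  rintro ⟨w, rfl | rfl | ⟨hw, hw'⟩⟩
  · exact Or.inr huv.symm
  · exact Or.inl huv
  · obtain ⟨d, hd, hdw⟩ := (hD w).resolve_left hw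
    by_contra! hcon
    exact hw' d hd (fun hdu => hcon.1 (hdu ▸ hdw)) (fun hdv => hcon.2 (hdv ▸ hdw)) hdw

open Classical in
/-- The set obtained from `D` by exchanging `u` and `v` for `x` and `y`. -/
noncomputable def exchange (D : Finset V) (u v x y : V) : Finset V :=
  insert x (insert y ((D.erase u).erase v))

theorem mem_exchange {x y w : V} :
    w ∈ exchange D u v x y ↔ w = x ∨ w = y ∨ w ≠ v ∧ w ≠ u ∧ w ∈ D := by
  simp [exchange]

theorem card_exchange_le (hu : u ∈ D) (hv : v ∈ D) (huv : u ≠ v) (x y : V) :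
    (exchange D u v x y).card ≤ D.card := by
  classical
  have hu' := Finset.card_erase_add_one hu
  have hv' := Finset.card_erase_add_one (Finset.mem_erase.2 ⟨huv.symm, hv⟩)
  have hx := Finset.card_insert_le x (insert y ((D.erase u).erase v))
  have hy := Finset.card_insert_le y ((D.erase u).erase v)
  unfold exchange
  convert (by omega : (insert x (insert y ((D.erase u).erase v))).card ≤ D.card)

theorem isDominating_exchange {x y : V}
    (h : ∀ w ∈ residue G D u v, w = x ∨ w = y ∨ G.Adj x w ∨ G.Adj y w) :
    IsDominating G (exchange D u v x y) := by
  intro w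
  by_cases hw : w ∈ residue G D u v
  · grind [mem_exchange]
  · simp only [residue, Set.mem_ofPred_eq] at hw
    grind [mem_exchange]

/-- The adjacent ordered pairs of vertices of `D`; the number of edges inside `D` is measured by
their number. -/
def adjPairs (G : SimpleGraph V) (D : Finset V) : Set (V × V) :=
  {p | p.1 ∈ D ∧ p.2 ∈ D ∧ G.Adj p.1 p.2}

theorem mem_of_adj_of_mem_exchange (hu : u ∈ D) (hv : v ∈ D) {x y : V}
    (hx : x ∈ residue G D u v) (hy : y ∈ residue G D u v) (hxy : ¬ G.Adj x y) {p q : V}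
    (hp : p ∈ exchange D u v x y) (hq : q ∈ exchange D u v x y) (hpq : G.Adj p q) : p ∈ D := by
  by_contra hpD
  have hpr : p ∈ residue G D u v := by grind [mem_exchange]
  have hpq' := hpq.symm
  have hne := hpq.ne
  simp only [residue, Set.mem_ofPred_eq] at hpr
  grind [mem_exchange]

theorem adjPairs_exchange_ssubset (hu : u ∈ D) (hv : v ∈ D) (huv : G.Adj u v) {x y : V}
    (hx : x ∈ residue G D u v) (hy : y ∈ residue G D u v) (hxy : ¬ G.Adj x y) :
    adjPairs G (exchange D u v x y) ⊂ adjPairs G D := by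
  refine (Set.ssubset_iff_of_subset ?_).2 ⟨(u, v), ⟨hu, hv, huv⟩, ?_⟩
  · rintro ⟨p, q⟩ ⟨hp, hq, hpq⟩
    exact ⟨mem_of_adj_of_mem_exchange hu hv hx hy hxy hp hq hpq,
      mem_of_adj_of_mem_exchange hu hv hx hy hxy hq hp hpq.symm, hpq⟩
  · rintro ⟨hu', hv', -⟩
    have hne := huv.ne
    have hvu := huv.symm
    grind [mem_exchange]

theorem exists_adjPairs_ssubset (hu : u ∈ D) (hv : v ∈ D) (huv : G.Adj u v)
    (h : ¬ NoIndepDominatingPair (G.induce (residue G D u v))) :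
    ∃ E : Finset V, IsDominating G E ∧ E.card ≤ D.card ∧ adjPairs G E ⊂ adjPairs G D := by
  simp only [NoIndepDominatingPair] at h
  push Not at h
  obtain ⟨⟨x, hx⟩, ⟨y, hy⟩, hxy, hdom⟩ := h
  refine ⟨exchange D u v x y, isDominating_exchange fun w hw => ?_,
    card_exchange_le hu hv huv.ne x y, adjPairs_exchange_ssubset hu hv huv hx hy hxy⟩
  have := hdom ⟨w, hw⟩
  simp only [SimpleGraph.compl_adj, SimpleGraph.comap_adj, Function.Embedding.subtype_apply, ne_eq,
    Subtype.mk.injEq] at this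
  tauto

theorem exists_isDominatingEdge_of_dominationNumber_ne [Finite V]
    (h : dominationNumber G ≠ independentDominationNumber G) :
    ∃ (S : Set V) (u v : S), NoIndepDominatingPair (G.induce S) ∧
      IsDominatingEdge (G.induce S) u v := by
  contrapose! h
  obtain ⟨D, ⟨hD, hcard⟩, hmin⟩ := Set.exists_min_image
    {D : Finset V | IsDominating G D ∧ D.card = dominationNumber G}
    (fun D => (adjPairs G D).ncard) (Set.toFinite _) (exists_isDominating_card G)
  refine (dominationNumber_le_independentDominationNumber G).antisymm ?_
  rw [← hcard]
  refine independentDominationNumber_le (maximal_isIndepSet_iff.2 ⟨?_, hD⟩)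
  intro u hu v hv _ huv
  have hres : ¬ NoIndepDominatingPair (G.induce (residue G D u v)) :=
    fun hres => h _ _ _ hres (hD.isDominatingEdge_residue huv)
  obtain ⟨E, hE, hED, hEdges⟩ := exists_adjPairs_ssubset hu hv huv hres
  have hEcard : E.card = dominationNumber G :=
    (hED.trans_eq hcard).antisymm (dominationNumber_le hE)
  exact (Set.ncard_lt_ncard hEdges).not_ge (hmin E ⟨hE, hEcard⟩)

instance (n : ℕ) (l : List (Fin n × Fin n)) : DecidableRel (graphOfEdges n l).Adj :=
  inferInstanceAs (DecidableRel (SimpleGraph.fromRel fun a b => (a, b) ∈ l).Adj)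

instance : ∀ j : Fin 17, DecidableRel (forbidden j).2.Adj
  | 0 | 1 | 2 | 3 | 4 | 5 | 6 | 7 | 8 | 9 | 10 | 11 | 12 | 13 | 14 | 15 | 16 =>
    inferInstanceAs (DecidableRel (graphOfEdges _ _).Adj)
  | ⟨_ + 17, h⟩ => absurd h (by omega)

theorem isIndContained_of_forall_lt {ι : Type*} [LinearOrder ι] {H : SimpleGraph ι} (f : ι → V)
    (h : ∀ i j, i < j → (H.Adj i j → G.Adj (f i) (f j)) ∧ (¬ H.Adj i j → Gᶜ.Adj (f i) (f j))) :
    H.IsIndContained G := by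
  have hadj (i j : ι) (hij : H.Adj i j) : G.Adj (f i) (f j) := by
    rcases hij.ne.lt_or_gt with hlt | hlt
    exacts [(h i j hlt).1 hij, ((h j i hlt).1 hij.symm).symm]
  have hcompl (i j : ι) (hne : i ≠ j) (hij : ¬ H.Adj i j) : Gᶜ.Adj (f i) (f j) := by
    rcases hne.lt_or_gt with hlt | hlt
    exacts [(h i j hlt).2 hij, ((h j i hlt).2 fun hji => hij hji.symm).symm]
  refine ⟨⟨⟨f, fun i j hij => ?_⟩, fun {i j} => ⟨fun hG => ?_, hadj i j⟩⟩⟩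
  · by_contra hne
    by_cases hH : H.Adj i j
    exacts [(hadj i j hH).ne hij, (hcompl i j hne hH).ne hij]
  · by_contra hH
    have hne : i ≠ j := fun hij => hG.ne (congrArg f hij)
    exact ((SimpleGraph.compl_adj ..).1 (hcompl i j hne hH)).2 hG

/-- `G` contains none of the seventeen graphs `G1, …, G17` as an induced subgraph. -/
def IsFree (G : SimpleGraph V) : Prop :=
  ∀ j, ¬ (forbidden j).2.IsIndContained G

theorem IsFree.of_isIndContained (h : IsFree G) (hHG : H.IsIndContained G) : IsFree H :=
  fun j hj => h j (hj.trans hHG)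

-- For literal `j` and `f`, `List.Forall` unfolds to the conjunction over all pairs `a < b`: the
-- lemmas below hold by computation.
theorem IsFree.not_forall_pairs (h : IsFree G) (j : Fin 17) (f : Fin (forbidden j).1 → V) :
    ¬ ((List.finRange _ ×ˢ List.finRange _).filter fun p => p.1 < p.2).Forall fun p =>
      if (forbidden j).2.Adj p.1 p.2 then G.Adj (f p.1) (f p.2) else Gᶜ.Adj (f p.1) (f p.2) := by
  rw [List.forall_iff_forall_mem]
  refine fun hf => h j (isIndContained_of_forall_lt f fun a b hab => ?_)
  have hpair := hf (a, b) (by simpa using hab)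
  split_ifs at hpair with hadj
  exacts [⟨fun _ => hpair, absurd hadj⟩, ⟨fun hadj' => absurd hadj' hadj, fun _ => hpair⟩]

theorem forbidden_noIndepDominatingPair (j : Fin 17) :
    NoIndepDominatingPair (forbidden j).2 := by
  revert j
  unfold NoIndepDominatingPair
  decide +kernel

theorem exists_isDominatingEdge_forbidden (j : Fin 17) :
    ∃ u v, IsDominatingEdge (forbidden j).2 u v := by
  revert j
  unfold IsDominatingEdge
  decide +kernel

local infix:50 " ∼ " => SimpleGraph.Adj G
local infix:50 " ≁ " => SimpleGraph.Adj Gᶜ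

theorem IsFree.not_G1 (h : IsFree G) (x₀ x₁ x₂ x₃ x₄ x₅ : V) :
    ¬ (x₀ ∼ x₁ ∧ x₀ ≁ x₂ ∧ x₀ ≁ x₃ ∧ x₀ ≁ x₄ ∧ x₀ ≁ x₅ ∧ x₁ ∼ x₂ ∧ x₁ ≁ x₃ ∧ x₁ ∼ x₄ ∧ x₁ ≁ x₅ ∧
    x₂ ≁ x₃ ∧ x₂ ≁ x₄ ∧ x₂ ≁ x₅ ∧ x₃ ∼ x₄ ∧ x₃ ≁ x₅ ∧ x₄ ∼ x₅) :=
  h.not_forall_pairs 0 ![x₀, x₁, x₂, x₃, x₄, x₅]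

theorem IsFree.not_G2 (h : IsFree G) (x₀ x₁ x₂ x₃ x₄ x₅ : V) :
    ¬ (x₀ ∼ x₁ ∧ x₀ ≁ x₂ ∧ x₀ ∼ x₃ ∧ x₀ ≁ x₄ ∧ x₀ ≁ x₅ ∧ x₁ ∼ x₂ ∧ x₁ ≁ x₃ ∧ x₁ ∼ x₄ ∧ x₁ ≁ x₅ ∧
    x₂ ≁ x₃ ∧ x₂ ≁ x₄ ∧ x₂ ≁ x₅ ∧ x₃ ∼ x₄ ∧ x₃ ≁ x₅ ∧ x₄ ∼ x₅) :=
  h.not_forall_pairs 1 ![x₀, x₁, x₂, x₃, x₄, x₅]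

theorem IsFree.not_G3 (h : IsFree G) (x₀ x₁ x₂ x₃ x₄ x₅ : V) :
    ¬ (x₀ ∼ x₁ ∧ x₀ ≁ x₂ ∧ x₀ ∼ x₃ ∧ x₀ ≁ x₄ ∧ x₀ ∼ x₅ ∧ x₁ ∼ x₂ ∧ x₁ ≁ x₃ ∧ x₁ ∼ x₄ ∧ x₁ ≁ x₅ ∧
    x₂ ≁ x₃ ∧ x₂ ≁ x₄ ∧ x₂ ≁ x₅ ∧ x₃ ∼ x₄ ∧ x₃ ≁ x₅ ∧ x₄ ∼ x₅) :=
  h.not_forall_pairs 2 ![x₀, x₁, x₂, x₃, x₄, x₅]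

theorem IsFree.not_G4 (h : IsFree G) (x₀ x₁ x₂ x₃ x₄ x₅ : V) :
    ¬ (x₀ ∼ x₁ ∧ x₀ ≁ x₂ ∧ x₀ ∼ x₃ ∧ x₀ ≁ x₄ ∧ x₀ ∼ x₅ ∧ x₁ ∼ x₂ ∧ x₁ ≁ x₃ ∧ x₁ ∼ x₄ ∧ x₁ ≁ x₅ ∧
    x₂ ∼ x₃ ∧ x₂ ≁ x₄ ∧ x₂ ∼ x₅ ∧ x₃ ∼ x₄ ∧ x₃ ≁ x₅ ∧ x₄ ∼ x₅) :=
  h.not_forall_pairs 3 ![x₀, x₁, x₂, x₃, x₄, x₅]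

theorem IsFree.not_G5 (h : IsFree G) (x₀ x₁ x₂ x₃ x₄ x₅ x₆ : V) :
    ¬ (x₀ ∼ x₁ ∧ x₀ ≁ x₂ ∧ x₀ ≁ x₃ ∧ x₀ ∼ x₄ ∧ x₀ ≁ x₅ ∧ x₀ ≁ x₆ ∧ x₁ ∼ x₂ ∧ x₁ ∼ x₃ ∧ x₁ ≁ x₄ ∧
    x₁ ∼ x₅ ∧ x₁ ≁ x₆ ∧ x₂ ≁ x₃ ∧ x₂ ≁ x₄ ∧ x₂ ≁ x₅ ∧ x₂ ∼ x₆ ∧ x₃ ≁ x₄ ∧ x₃ ∼ x₅ ∧ x₃ ≁ x₆ ∧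
    x₄ ∼ x₅ ∧ x₄ ≁ x₆ ∧ x₅ ∼ x₆) :=
  h.not_forall_pairs 4 ![x₀, x₁, x₂, x₃, x₄, x₅, x₆]

theorem IsFree.not_G6 (h : IsFree G) (x₀ x₁ x₂ x₃ x₄ x₅ x₆ : V) :
    ¬ (x₀ ∼ x₁ ∧ x₀ ≁ x₂ ∧ x₀ ∼ x₃ ∧ x₀ ∼ x₄ ∧ x₀ ≁ x₅ ∧ x₀ ∼ x₆ ∧ x₁ ∼ x₂ ∧ x₁ ∼ x₃ ∧ x₁ ≁ x₄ ∧
    x₁ ∼ x₅ ∧ x₁ ≁ x₆ ∧ x₂ ≁ x₃ ∧ x₂ ≁ x₄ ∧ x₂ ≁ x₅ ∧ x₂ ∼ x₆ ∧ x₃ ≁ x₄ ∧ x₃ ∼ x₅ ∧ x₃ ∼ x₆ ∧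
    x₄ ∼ x₅ ∧ x₄ ≁ x₆ ∧ x₅ ∼ x₆) :=
  h.not_forall_pairs 5 ![x₀, x₁, x₂, x₃, x₄, x₅, x₆]

theorem IsFree.not_G7 (h : IsFree G) (x₀ x₁ x₂ x₃ x₄ x₅ x₆ x₇ : V) :
    ¬ (x₀ ∼ x₁ ∧ x₀ ≁ x₂ ∧ x₀ ≁ x₃ ∧ x₀ ≁ x₄ ∧ x₀ ∼ x₅ ∧ x₀ ≁ x₆ ∧ x₀ ≁ x₇ ∧ x₁ ∼ x₂ ∧ x₁ ∼ x₃ ∧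
    x₁ ∼ x₄ ∧ x₁ ≁ x₅ ∧ x₁ ∼ x₆ ∧ x₁ ≁ x₇ ∧ x₂ ∼ x₃ ∧ x₂ ≁ x₄ ∧ x₂ ≁ x₅ ∧ x₂ ≁ x₆ ∧ x₂ ∼ x₇ ∧
    x₃ ≁ x₄ ∧ x₃ ≁ x₅ ∧ x₃ ∼ x₆ ∧ x₃ ≁ x₇ ∧ x₄ ≁ x₅ ∧ x₄ ∼ x₆ ∧ x₄ ∼ x₇ ∧ x₅ ∼ x₆ ∧ x₅ ≁ x₇ ∧
    x₆ ∼ x₇) :=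
  h.not_forall_pairs 6 ![x₀, x₁, x₂, x₃, x₄, x₅, x₆, x₇]

theorem IsFree.not_G8 (h : IsFree G) (x₀ x₁ x₂ x₃ x₄ x₅ x₆ x₇ : V) :
    ¬ (x₀ ∼ x₁ ∧ x₀ ≁ x₂ ∧ x₀ ≁ x₃ ∧ x₀ ≁ x₄ ∧ x₀ ∼ x₅ ∧ x₀ ≁ x₆ ∧ x₀ ≁ x₇ ∧ x₁ ∼ x₂ ∧ x₁ ∼ x₃ ∧
    x₁ ∼ x₄ ∧ x₁ ≁ x₅ ∧ x₁ ∼ x₆ ∧ x₁ ≁ x₇ ∧ x₂ ≁ x₃ ∧ x₂ ≁ x₄ ∧ x₂ ≁ x₅ ∧ x₂ ≁ x₆ ∧ x₂ ∼ x₇ ∧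
    x₃ ≁ x₄ ∧ x₃ ∼ x₅ ∧ x₃ ∼ x₆ ∧ x₃ ≁ x₇ ∧ x₄ ≁ x₅ ∧ x₄ ∼ x₆ ∧ x₄ ∼ x₇ ∧ x₅ ∼ x₆ ∧ x₅ ≁ x₇ ∧
    x₆ ∼ x₇) :=
  h.not_forall_pairs 7 ![x₀, x₁, x₂, x₃, x₄, x₅, x₆, x₇]

theorem IsFree.not_G9 (h : IsFree G) (x₀ x₁ x₂ x₃ x₄ x₅ x₆ x₇ : V) :
    ¬ (x₀ ∼ x₁ ∧ x₀ ≁ x₂ ∧ x₀ ≁ x₃ ∧ x₀ ≁ x₄ ∧ x₀ ∼ x₅ ∧ x₀ ≁ x₆ ∧ x₀ ≁ x₇ ∧ x₁ ∼ x₂ ∧ x₁ ∼ x₃ ∧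
    x₁ ∼ x₄ ∧ x₁ ≁ x₅ ∧ x₁ ∼ x₆ ∧ x₁ ≁ x₇ ∧ x₂ ∼ x₃ ∧ x₂ ≁ x₄ ∧ x₂ ≁ x₅ ∧ x₂ ≁ x₆ ∧ x₂ ∼ x₇ ∧
    x₃ ≁ x₄ ∧ x₃ ∼ x₅ ∧ x₃ ∼ x₆ ∧ x₃ ≁ x₇ ∧ x₄ ≁ x₅ ∧ x₄ ∼ x₆ ∧ x₄ ∼ x₇ ∧ x₅ ∼ x₆ ∧ x₅ ≁ x₇ ∧
    x₆ ∼ x₇) :=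
  h.not_forall_pairs 8 ![x₀, x₁, x₂, x₃, x₄, x₅, x₆, x₇]

theorem IsFree.not_G10 (h : IsFree G) (x₀ x₁ x₂ x₃ x₄ x₅ x₆ x₇ : V) :
    ¬ (x₀ ∼ x₁ ∧ x₀ ≁ x₂ ∧ x₀ ≁ x₃ ∧ x₀ ≁ x₄ ∧ x₀ ∼ x₅ ∧ x₀ ≁ x₆ ∧ x₀ ≁ x₇ ∧ x₁ ∼ x₂ ∧ x₁ ∼ x₃ ∧
    x₁ ∼ x₄ ∧ x₁ ≁ x₅ ∧ x₁ ∼ x₆ ∧ x₁ ≁ x₇ ∧ x₂ ∼ x₃ ∧ x₂ ≁ x₄ ∧ x₂ ≁ x₅ ∧ x₂ ≁ x₆ ∧ x₂ ∼ x₇ ∧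
    x₃ ∼ x₄ ∧ x₃ ≁ x₅ ∧ x₃ ∼ x₆ ∧ x₃ ≁ x₇ ∧ x₄ ≁ x₅ ∧ x₄ ∼ x₆ ∧ x₄ ∼ x₇ ∧ x₅ ∼ x₆ ∧ x₅ ≁ x₇ ∧
    x₆ ∼ x₇) :=
  h.not_forall_pairs 9 ![x₀, x₁, x₂, x₃, x₄, x₅, x₆, x₇]

theorem IsFree.not_G11 (h : IsFree G) (x₀ x₁ x₂ x₃ x₄ x₅ x₆ x₇ : V) :
    ¬ (x₀ ∼ x₁ ∧ x₀ ≁ x₂ ∧ x₀ ≁ x₃ ∧ x₀ ≁ x₄ ∧ x₀ ∼ x₅ ∧ x₀ ≁ x₆ ∧ x₀ ≁ x₇ ∧ x₁ ∼ x₂ ∧ x₁ ∼ x₃ ∧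
    x₁ ∼ x₄ ∧ x₁ ≁ x₅ ∧ x₁ ∼ x₆ ∧ x₁ ≁ x₇ ∧ x₂ ≁ x₃ ∧ x₂ ≁ x₄ ∧ x₂ ≁ x₅ ∧ x₂ ≁ x₆ ∧ x₂ ∼ x₇ ∧
    x₃ ∼ x₄ ∧ x₃ ∼ x₅ ∧ x₃ ∼ x₆ ∧ x₃ ≁ x₇ ∧ x₄ ≁ x₅ ∧ x₄ ∼ x₆ ∧ x₄ ∼ x₇ ∧ x₅ ∼ x₆ ∧ x₅ ≁ x₇ ∧
    x₆ ∼ x₇) :=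
  h.not_forall_pairs 10 ![x₀, x₁, x₂, x₃, x₄, x₅, x₆, x₇]

theorem IsFree.not_G12 (h : IsFree G) (x₀ x₁ x₂ x₃ x₄ x₅ x₆ x₇ : V) :
    ¬ (x₀ ∼ x₁ ∧ x₀ ≁ x₂ ∧ x₀ ≁ x₃ ∧ x₀ ≁ x₄ ∧ x₀ ∼ x₅ ∧ x₀ ≁ x₆ ∧ x₀ ≁ x₇ ∧ x₁ ∼ x₂ ∧ x₁ ∼ x₃ ∧
    x₁ ∼ x₄ ∧ x₁ ≁ x₅ ∧ x₁ ∼ x₆ ∧ x₁ ≁ x₇ ∧ x₂ ∼ x₃ ∧ x₂ ≁ x₄ ∧ x₂ ≁ x₅ ∧ x₂ ≁ x₆ ∧ x₂ ∼ x₇ ∧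
    x₃ ∼ x₄ ∧ x₃ ∼ x₅ ∧ x₃ ∼ x₆ ∧ x₃ ≁ x₇ ∧ x₄ ≁ x₅ ∧ x₄ ∼ x₆ ∧ x₄ ∼ x₇ ∧ x₅ ∼ x₆ ∧ x₅ ≁ x₇ ∧
    x₆ ∼ x₇) :=
  h.not_forall_pairs 11 ![x₀, x₁, x₂, x₃, x₄, x₅, x₆, x₇]

theorem IsFree.not_G13 (h : IsFree G) (x₀ x₁ x₂ x₃ x₄ x₅ x₆ x₇ : V) :
    ¬ (x₀ ∼ x₁ ∧ x₀ ≁ x₂ ∧ x₀ ≁ x₃ ∧ x₀ ∼ x₄ ∧ x₀ ∼ x₅ ∧ x₀ ≁ x₆ ∧ x₀ ≁ x₇ ∧ x₁ ∼ x₂ ∧ x₁ ∼ x₃ ∧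
    x₁ ∼ x₄ ∧ x₁ ≁ x₅ ∧ x₁ ∼ x₆ ∧ x₁ ≁ x₇ ∧ x₂ ∼ x₃ ∧ x₂ ≁ x₄ ∧ x₂ ≁ x₅ ∧ x₂ ≁ x₆ ∧ x₂ ∼ x₇ ∧
    x₃ ∼ x₄ ∧ x₃ ∼ x₅ ∧ x₃ ∼ x₆ ∧ x₃ ≁ x₇ ∧ x₄ ≁ x₅ ∧ x₄ ∼ x₆ ∧ x₄ ∼ x₇ ∧ x₅ ∼ x₆ ∧ x₅ ≁ x₇ ∧
    x₆ ∼ x₇) :=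
  h.not_forall_pairs 12 ![x₀, x₁, x₂, x₃, x₄, x₅, x₆, x₇]

theorem IsFree.not_G14 (h : IsFree G) (x₀ x₁ x₂ x₃ x₄ x₅ x₆ x₇ x₈ : V) :
    ¬ (x₀ ≁ x₁ ∧ x₀ ∼ x₂ ∧ x₀ ∼ x₃ ∧ x₀ ≁ x₄ ∧ x₀ ≁ x₅ ∧ x₀ ∼ x₆ ∧ x₀ ∼ x₇ ∧ x₀ ≁ x₈ ∧ x₁ ∼ x₂ ∧
    x₁ ≁ x₃ ∧ x₁ ≁ x₄ ∧ x₁ ∼ x₅ ∧ x₁ ∼ x₆ ∧ x₁ ≁ x₇ ∧ x₁ ≁ x₈ ∧ x₂ ∼ x₃ ∧ x₂ ∼ x₄ ∧ x₂ ∼ x₅ ∧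
    x₂ ≁ x₆ ∧ x₂ ∼ x₇ ∧ x₂ ≁ x₈ ∧ x₃ ∼ x₄ ∧ x₃ ≁ x₅ ∧ x₃ ≁ x₆ ∧ x₃ ≁ x₇ ∧ x₃ ∼ x₈ ∧ x₄ ≁ x₅ ∧
    x₄ ∼ x₆ ∧ x₄ ∼ x₇ ∧ x₄ ≁ x₈ ∧ x₅ ≁ x₆ ∧ x₅ ∼ x₇ ∧ x₅ ∼ x₈ ∧ x₆ ∼ x₇ ∧ x₆ ≁ x₈ ∧ x₇ ∼ x₈) :=
  h.not_forall_pairs 13 ![x₀, x₁, x₂, x₃, x₄, x₅, x₆, x₇, x₈]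

theorem IsFree.not_G15 (h : IsFree G) (x₀ x₁ x₂ x₃ x₄ x₅ x₆ x₇ x₈ : V) :
    ¬ (x₀ ∼ x₁ ∧ x₀ ∼ x₂ ∧ x₀ ≁ x₃ ∧ x₀ ≁ x₄ ∧ x₀ ≁ x₅ ∧ x₀ ∼ x₆ ∧ x₀ ∼ x₇ ∧ x₀ ≁ x₈ ∧ x₁ ∼ x₂ ∧
    x₁ ≁ x₃ ∧ x₁ ≁ x₄ ∧ x₁ ∼ x₅ ∧ x₁ ∼ x₆ ∧ x₁ ≁ x₇ ∧ x₁ ≁ x₈ ∧ x₂ ∼ x₃ ∧ x₂ ∼ x₄ ∧ x₂ ∼ x₅ ∧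
    x₂ ≁ x₆ ∧ x₂ ∼ x₇ ∧ x₂ ≁ x₈ ∧ x₃ ∼ x₄ ∧ x₃ ≁ x₅ ∧ x₃ ≁ x₆ ∧ x₃ ≁ x₇ ∧ x₃ ∼ x₈ ∧ x₄ ≁ x₅ ∧
    x₄ ∼ x₆ ∧ x₄ ∼ x₇ ∧ x₄ ≁ x₈ ∧ x₅ ≁ x₆ ∧ x₅ ∼ x₇ ∧ x₅ ∼ x₈ ∧ x₆ ∼ x₇ ∧ x₆ ≁ x₈ ∧ x₇ ∼ x₈) :=
  h.not_forall_pairs 14 ![x₀, x₁, x₂, x₃, x₄, x₅, x₆, x₇, x₈]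

theorem IsFree.not_G16 (h : IsFree G) (x₀ x₁ x₂ x₃ x₄ x₅ x₆ x₇ x₈ : V) :
    ¬ (x₀ ∼ x₁ ∧ x₀ ∼ x₂ ∧ x₀ ∼ x₃ ∧ x₀ ≁ x₄ ∧ x₀ ≁ x₅ ∧ x₀ ∼ x₆ ∧ x₀ ∼ x₇ ∧ x₀ ∼ x₈ ∧ x₁ ∼ x₂ ∧
    x₁ ≁ x₃ ∧ x₁ ≁ x₄ ∧ x₁ ∼ x₅ ∧ x₁ ∼ x₆ ∧ x₁ ≁ x₇ ∧ x₁ ≁ x₈ ∧ x₂ ∼ x₃ ∧ x₂ ∼ x₄ ∧ x₂ ∼ x₅ ∧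
    x₂ ≁ x₆ ∧ x₂ ∼ x₇ ∧ x₂ ≁ x₈ ∧ x₃ ∼ x₄ ∧ x₃ ≁ x₅ ∧ x₃ ≁ x₆ ∧ x₃ ≁ x₇ ∧ x₃ ∼ x₈ ∧ x₄ ≁ x₅ ∧
    x₄ ∼ x₆ ∧ x₄ ∼ x₇ ∧ x₄ ≁ x₈ ∧ x₅ ≁ x₆ ∧ x₅ ∼ x₇ ∧ x₅ ∼ x₈ ∧ x₆ ∼ x₇ ∧ x₆ ≁ x₈ ∧ x₇ ∼ x₈) :=
  h.not_forall_pairs 15 ![x₀, x₁, x₂, x₃, x₄, x₅, x₆, x₇, x₈]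

theorem IsFree.not_G17 (h : IsFree G) (x₀ x₁ x₂ x₃ x₄ x₅ x₆ x₇ x₈ x₉ x₁₀ : V) :
    ¬ (x₀ ∼ x₁ ∧ x₀ ∼ x₂ ∧ x₀ ∼ x₃ ∧ x₀ ∼ x₄ ∧ x₀ ∼ x₅ ∧ x₀ ≁ x₆ ∧ x₀ ≁ x₇ ∧ x₀ ∼ x₈ ∧ x₀ ≁ x₉ ∧
    x₀ ≁ x₁₀ ∧ x₁ ∼ x₂ ∧ x₁ ≁ x₃ ∧ x₁ ≁ x₄ ∧ x₁ ∼ x₅ ∧ x₁ ∼ x₆ ∧ x₁ ≁ x₇ ∧ x₁ ≁ x₈ ∧ x₁ ∼ x₉ ∧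
    x₁ ≁ x₁₀ ∧ x₂ ∼ x₃ ∧ x₂ ∼ x₄ ∧ x₂ ∼ x₅ ∧ x₂ ≁ x₆ ∧ x₂ ∼ x₇ ∧ x₂ ≁ x₈ ∧ x₂ ∼ x₉ ∧ x₂ ∼ x₁₀ ∧
    x₃ ∼ x₄ ∧ x₃ ≁ x₅ ∧ x₃ ≁ x₆ ∧ x₃ ≁ x₇ ∧ x₃ ∼ x₈ ∧ x₃ ∼ x₉ ∧ x₃ ∼ x₁₀ ∧ x₄ ≁ x₅ ∧ x₄ ∼ x₆ ∧
    x₄ ∼ x₇ ∧ x₄ ≁ x₈ ∧ x₄ ≁ x₉ ∧ x₄ ≁ x₁₀ ∧ x₅ ≁ x₆ ∧ x₅ ∼ x₇ ∧ x₅ ∼ x₈ ∧ x₅ ≁ x₉ ∧ x₅ ∼ x₁₀ ∧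
    x₆ ∼ x₇ ∧ x₆ ≁ x₈ ∧ x₆ ∼ x₉ ∧ x₆ ≁ x₁₀ ∧ x₇ ∼ x₈ ∧ x₇ ≁ x₉ ∧ x₇ ∼ x₁₀ ∧ x₈ ≁ x₉ ∧ x₈ ∼ x₁₀ ∧
    x₉ ∼ x₁₀) :=
  h.not_forall_pairs 16 ![x₀, x₁, x₂, x₃, x₄, x₅, x₆, x₇, x₈, x₉, x₁₀]

attribute [local grind =] SimpleGraph.compl_adj SimpleGraph.adj_comm

/-- A free graph with a dominating edge `uv` but without independent dominating pair: the
hypothetical object that the rest of the argument refutes. -/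
structure IsCounterexample (G : SimpleGraph V) (u v : V) : Prop where
  isFree : IsFree G
  noIndepDominatingPair : NoIndepDominatingPair G
  isDominatingEdge : IsDominatingEdge G u v

variable (G) in
/-- `a` is a private neighbour of `u` relative to `v`. As `v ≁ a` is adjacency in the complement, it
includes `a ≠ v`. -/
abbrev IsPrivate (u v a : V) : Prop :=
  u ∼ a ∧ v ≁ a

variable (G) in
/-- `c` is a common neighbour of `u` and `v`. -/
abbrev IsCommon (u v c : V) : Prop :=
  u ∼ c ∧ v ∼ c

variable {a a' a₁ a₂ b b' b₁ b₂ c d e f g k t w x y z : V}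

theorem IsCounterexample.symm (h : IsCounterexample G u v) : IsCounterexample G v u :=
  ⟨h.isFree, h.noIndepDominatingPair, h.isDominatingEdge.1.symm,
    fun w => (h.isDominatingEdge.2 w).symm⟩

theorem IsCounterexample.adj (h : IsCounterexample G u v) : u ∼ v :=
  h.isDominatingEdge.1

attribute [local grind →] IsCounterexample.adj

theorem IsCounterexample.exists_not_adj (h : IsCounterexample G u v) (hx : IsCommon G u v x)
    (hxy : ¬ x ∼ y) :
    ∃ w, x ≁ w ∧ y ≁ w ∧ (IsPrivate G u v w ∨ IsPrivate G v u w ∨ IsCommon G u v w) := by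
  obtain ⟨w, hxw, hyw⟩ := h.noIndepDominatingPair x y hxy
  refine ⟨w, hxw, hyw, ?_⟩
  have := h.isDominatingEdge.2 w
  grind

theorem IsCounterexample.exists_isPrivate (h : IsCounterexample G u v) (hx : ¬ v ∼ x) :
    ∃ a, IsPrivate G u v a ∧ x ≁ a := by
  obtain ⟨a, hv, hxa⟩ := h.noIndepDominatingPair v x hx
  have := h.isDominatingEdge.2 a
  grind

-- In a goal closed by `grind [h.isFree.not_Gk x₀ x₁ …]` the wrong choice of an adjacency would
-- complete an induced copy of `Gₖ` whose vertices `0, 1, …` are `x₀, x₁, …`.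
theorem IsCounterexample.adj_or_adj (h : IsCounterexample G u v) (ha : IsPrivate G u v a)
    (ha' : IsPrivate G u v a') (haa : a ≁ a') (hb : IsPrivate G v u b) : a ∼ b ∨ a' ∼ b := by
  by_contra! hn
  obtain ⟨w, hw, hbw⟩ := h.symm.exists_isPrivate (x := b) (by grind)
  have hwa : a ∼ w := by grind [h.isFree.not_G1 w v b a u a', h.isFree.not_G2 w v b a' u a]
  have hwa' : a' ∼ w := by grind [h.isFree.not_G2 w v b a u a']
  grind [h.isFree.not_G3 w v b a u a']

theorem IsCounterexample.exists_isCommon (h : IsCounterexample G u v) (ha : IsPrivate G u v a)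
    (hb : IsPrivate G v u b) (hab : a ≁ b) : ∃ c, IsCommon G u v c ∧ a ≁ c ∧ b ≁ c := by
  obtain ⟨c, hac, hbc⟩ := h.noIndepDominatingPair a b (by grind)
  have hcA : ¬ IsPrivate G u v c := fun hc => by grind [h.adj_or_adj ha hc hac hb]
  have hcB : ¬ IsPrivate G v u c := fun hc => by grind [h.symm.adj_or_adj hb hc hbc ha]
  refine ⟨c, ?_, hac, hbc⟩
  grind [h.isDominatingEdge.2 c]

theorem IsCounterexample.adj_of_adj_of_adj (h : IsCounterexample G u v) (ha : IsPrivate G u v a)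
    (ha' : IsPrivate G u v a') (haa : a ≁ a') (hb : IsPrivate G v u b) (hb' : IsPrivate G v u b')
    (hbb : b ≁ b') (hab : a ∼ b) (hab' : a' ∼ b) : a ∼ b' := by
  by_contra hn
  have hab₁ : a' ∼ b' := (h.adj_or_adj ha ha' haa hb').resolve_left hn
  obtain ⟨w, hw, haw, hbw⟩ := h.exists_isCommon ha hb' (by grind)
  by_cases hwb : w ∼ b <;> by_cases hwa' : w ∼ a'
  · grind [h.isFree.not_G6 u a' b' w a b v]
  · grind [h.isFree.not_G3 u a' b' a b w]
  · grind [h.isFree.not_G3 a' b a w v b']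
  · grind [h.isFree.not_G2 b a' b' a u w]

theorem IsCounterexample.adj_iff_not_adj (h : IsCounterexample G u v) (a a' b : V)
    (ha : IsPrivate G u v a) (ha' : IsPrivate G u v a') (haa : a ≁ a') (hb : IsPrivate G v u b) :
    a ∼ b ↔ ¬ a' ∼ b := by
  refine ⟨fun hab hab' => ?_, fun hn => (h.adj_or_adj ha ha' haa hb).resolve_right hn⟩
  obtain ⟨b', hb', hbb⟩ := h.symm.exists_isPrivate (x := b) (by grind)
  have hab₁ := h.adj_of_adj_of_adj ha ha' haa hb hb' hbb hab hab'
  have hab₂ := h.adj_of_adj_of_adj ha' ha haa.symm hb hb' hbb hab' hab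
  grind [h.isFree.not_G4 v b a b' a' u]

variable (G u v) in
/-- Two nonadjacent private neighbours `a₁`, `a₂` of `u` and two nonadjacent private neighbours
`b₁`, `b₂` of `v`, joined by the matching `a₁b₁`, `a₂b₂`: an induced domino, the hexagon
`u a₁ b₁ v b₂ a₂` with the chord `uv`. -/
abbrev IsDomino (a₁ a₂ b₁ b₂ : V) : Prop :=
  IsPrivate G u v a₁ ∧ IsPrivate G u v a₂ ∧ IsPrivate G v u b₁ ∧ IsPrivate G v u b₂ ∧
    a₁ ≁ a₂ ∧ b₁ ≁ b₂ ∧ a₁ ∼ b₁ ∧ a₂ ∼ b₂ ∧ a₁ ≁ b₂ ∧ a₂ ≁ b₁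

theorem IsCounterexample.not_forall_not_adj (h : IsCounterexample G u v)
    (hD : IsDomino G u v a₁ a₂ b₁ b₂) (hc : IsCommon G u v c) :
    ¬ (a₁ ≁ c ∧ a₂ ≁ c ∧ b₁ ≁ c ∧ b₂ ≁ c) := by
  grind [h.isFree.not_G5 a₁ u a₂ c b₁ v b₂]

theorem IsCounterexample.adj_of_isDomino (h : IsCounterexample G u v) (a₁ a₂ b₁ b₂ c : V)
    (hD : IsDomino G u v a₁ a₂ b₁ b₂) (hc : IsCommon G u v c) (ha₁ : a₁ ≁ c) (ha₂ : a₂ ≁ c) :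
    b₁ ∼ c := by
  by_contra hb₁
  have hcb₂ : c ∼ b₂ := by grind [h.not_forall_not_adj hD hc]
  obtain ⟨w, hw, hwa₁, hwb₂⟩ := h.exists_isCommon (a := a₁) (b := b₂) (by grind) (by grind)
    (by grind)
  have hwa₂ : w ∼ a₂ := by
    grind [h.isFree.not_G5 a₂ u a₁ w b₂ v b₁, h.isFree.not_G8 a₁ u a₂ w c b₁ v b₂,
      h.isFree.not_G11 a₁ u a₂ w c b₁ v b₂]
  have hwb₁ : w ∼ b₁ := by
    grind [h.isFree.not_G7 a₁ u a₂ w c b₁ v b₂, h.isFree.not_G10 a₁ u a₂ w c b₁ v b₂]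
  grind [h.isFree.not_G9 a₁ u a₂ w c b₁ v b₂, h.isFree.not_G12 a₁ u a₂ w c b₁ v b₂]

variable (G u v) in
/-- A domino with two nonadjacent common neighbours `c`, `d`, where `c` sees the diagonal `a₂`, `b₁`
and `d` sees the diagonal `a₁`, `b₂`. -/
abbrev IsCrossing (a₁ a₂ b₁ b₂ c d : V) : Prop :=
  IsDomino G u v a₁ a₂ b₁ b₂ ∧ IsCommon G u v c ∧ IsCommon G u v d ∧ c ≁ d ∧
    c ≁ a₁ ∧ c ∼ a₂ ∧ c ∼ b₁ ∧ c ≁ b₂ ∧ d ∼ a₁ ∧ d ≁ a₂ ∧ d ≁ b₁ ∧ d ∼ b₂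

variable (G u v) in
/-- A crossing with a private neighbour `x` of `v` adjacent to neither `c` nor `d`; the other
adjacencies of `x` are then forced. -/
abbrev IsWitnessedCrossing (a₁ a₂ b₁ b₂ c d x : V) : Prop :=
  IsCrossing G u v a₁ a₂ b₁ b₂ c d ∧ IsPrivate G v u x ∧
    a₁ ∼ x ∧ a₂ ≁ x ∧ b₁ ∼ x ∧ b₂ ∼ x ∧ c ≁ x ∧ d ≁ x

theorem IsCommon.symm (hc : IsCommon G u v c) : IsCommon G v u c :=
  ⟨hc.2, hc.1⟩

theorem IsCrossing.swap (hX : IsCrossing G u v a₁ a₂ b₁ b₂ c d) :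
    IsCrossing G u v a₂ a₁ b₂ b₁ d c := by
  grind

theorem IsCrossing.symm (hX : IsCrossing G u v a₁ a₂ b₁ b₂ c d) :
    IsCrossing G v u b₁ b₂ a₁ a₂ d c := by
  grind

theorem IsCounterexample.isCrossing (h : IsCounterexample G u v) (a₁ a₂ b₁ b₂ c d : V)
    (hD : IsDomino G u v a₁ a₂ b₁ b₂) (hc : IsCommon G u v c) (hd : IsCommon G u v d)
    (hca₁ : c ≁ a₁) (hcb₂ : c ≁ b₂) (hda₂ : d ≁ a₂) (hdb₁ : d ≁ b₁) :
    IsCrossing G u v a₁ a₂ b₁ b₂ c d := by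
  have hca₂ : c ∼ a₂ := by grind [h.adj_of_isDomino a₂ a₁ b₂ b₁ c]
  have hcb₁ : c ∼ b₁ := by grind [h.symm.adj_of_isDomino b₁ b₂ a₁ a₂ c]
  have hda₁ : d ∼ a₁ := by grind [h.adj_of_isDomino a₁ a₂ b₁ b₂ d]
  have hdb₂ : d ∼ b₂ := by grind [h.symm.adj_of_isDomino b₂ b₁ a₂ a₁ d]
  have hcd : c ≁ d := by grind [h.isFree.not_G13 a₁ u a₂ c d b₁ v b₂]
  grind

theorem IsCounterexample.exists_isCrossing (h : IsCounterexample G u v) :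
    ∃ a₁ a₂ b₁ b₂ c d, IsCrossing G u v a₁ a₂ b₁ b₂ c d := by
  obtain ⟨a, ha, -⟩ := h.exists_isPrivate (x := v) G.irrefl
  obtain ⟨a', ha', haa⟩ := h.exists_isPrivate (x := a) (by grind)
  obtain ⟨b₁, hb₁, -⟩ := h.symm.exists_isPrivate (x := u) G.irrefl
  obtain ⟨b₂, hb₂, hbb⟩ := h.symm.exists_isPrivate (x := b₁) (by grind)
  obtain ⟨a₁, a₂, hD⟩ : ∃ a₁ a₂, IsDomino G u v a₁ a₂ b₁ b₂ := by
    by_cases hab : a ∼ b₁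
    · exact ⟨a, a', by grind [h.adj_iff_not_adj a a' b₁, h.adj_iff_not_adj a a' b₂,
        h.symm.adj_iff_not_adj b₁ b₂ a]⟩
    · exact ⟨a', a, by grind [h.adj_iff_not_adj a a' b₁, h.adj_iff_not_adj a a' b₂,
        h.symm.adj_iff_not_adj b₁ b₂ a]⟩
  have ⟨ha₁, ha₂, _, _, _, _, _, _, hab₁₂, hab₂₁⟩ := hD
  obtain ⟨c, hc, hca₁, hcb₂⟩ := h.exists_isCommon ha₁ hb₂ hab₁₂
  obtain ⟨d, hd, hda₂, hdb₁⟩ := h.exists_isCommon ha₂ hb₁ hab₂₁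
  exact ⟨a₁, a₂, b₁, b₂, c, d, h.isCrossing a₁ a₂ b₁ b₂ c d hD hc hd hca₁.symm hcb₂.symm
    hda₂.symm hdb₁.symm⟩

theorem IsCounterexample.not_adj_pair_of_isCrossing (h : IsCounterexample G u v)
    (hX : IsCrossing G u v a₁ a₂ b₁ b₂ c d) (hx : IsCommon G u v x) (hcx : c ≁ x)
    (hdx : d ≁ x) : ¬ (x ∼ a₁ ∧ x ∼ a₂) := by
  grind [h.isFree.not_G3 a₁ x a₂ b₁ v d, h.isFree.not_G3 a₂ x a₁ b₂ v c,
    h.isFree.not_G3 b₁ x b₂ a₁ u c, h.isFree.not_G16 x b₁ v b₂ d c a₁ u a₂]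

theorem IsCounterexample.not_compl_adj_of_isCrossing (h : IsCounterexample G u v)
    (a₁ a₂ b₁ b₂ c d x : V) (hX : IsCrossing G u v a₁ a₂ b₁ b₂ c d)
    (hx : IsCommon G u v x) (hcx : c ≁ x) : ¬ d ≁ x := by
  intro hdx
  have hxa := h.not_adj_pair_of_isCrossing hX hx hcx hdx
  have hxb := h.symm.not_adj_pair_of_isCrossing hX.symm hx.symm hdx hcx
  have hxa' : x ∼ a₁ ∨ x ∼ a₂ := by
    grind [h.adj_of_isDomino a₁ a₂ b₁ b₂ x, h.adj_of_isDomino a₂ a₁ b₂ b₁ x]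
  have hxb' : x ∼ b₁ ∨ x ∼ b₂ := by
    grind [h.symm.adj_of_isDomino b₁ b₂ a₁ a₂ x, h.symm.adj_of_isDomino b₂ b₁ a₂ a₁ x]
  rcases hxa' with hx₁ | hx₂ <;> rcases hxb' with hx₃ | hx₄
  · grind [h.isFree.not_G15 x b₁ v b₂ d c a₁ u a₂]
  · grind [h.isFree.not_G14 x b₁ v b₂ d c a₁ u a₂]
  · grind [h.isFree.not_G14 x a₁ u a₂ c d b₁ v b₂]
  · grind [h.isFree.not_G15 x b₂ v b₁ c d a₂ u a₁]

variable (G u v) in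
/-- Two crossings sharing `a₁`, `a₂` and the common neighbour `d`, the second one replacing `b₁`,
`b₂` by the witness `x` and a vertex `y` adjacent to `b₁`. -/
abbrev IsDoubleCrossing (a₁ a₂ b₁ b₂ x y c d e : V) : Prop :=
  IsWitnessedCrossing G u v a₁ a₂ b₁ b₂ c d x ∧ IsCrossing G u v a₁ a₂ x y e d ∧ b₁ ∼ y ∧ e ∼ b₁

variable (G u v) in
/-- A double crossing with a third crossing, which keeps `x`, `y`, `d` and replaces `a₁`, `a₂` by
`w`, `z`. -/
abbrev IsTripleCrossing (a₁ a₂ b₁ b₂ x y w z c d e f : V) : Prop :=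
  IsDoubleCrossing G u v a₁ a₂ b₁ b₂ x y c d e ∧ IsCrossing G u v w z x y f d ∧
    a₁ ∼ z ∧ a₂ ∼ z ∧ b₁ ∼ z ∧ b₂ ≁ z ∧ c ∼ z ∧ e ≁ z ∧
    a₁ ∼ w ∧ a₂ ∼ w ∧ b₁ ≁ w ∧ b₂ ∼ w ∧ c ≁ w ∧ e ∼ w ∧
    f ∼ c ∧ f ∼ e ∧ f ∼ a₂ ∧ f ∼ b₁

theorem IsCounterexample.isWitnessedCrossing (h : IsCounterexample G u v)
    (hX : IsCrossing G u v a₁ a₂ b₁ b₂ c d) (hx : IsPrivate G v u x) (hxa₁ : x ∼ a₁)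
    (hcx : c ≁ x) (hdx : d ≁ x) : IsWitnessedCrossing G u v a₁ a₂ b₁ b₂ c d x := by
  have hxa₂ : x ≁ a₂ := by grind [h.adj_iff_not_adj a₁ a₂ x]
  have hxb₁ : x ∼ b₁ := by grind [h.symm.adj_iff_not_adj b₁ x a₁]
  have hxb₂ : x ∼ b₂ := by grind [h.symm.adj_of_isDomino x b₂ a₁ a₂ c]
  grind

theorem IsCounterexample.exists_isWitnessedCrossing (h : IsCounterexample G u v) :
    ∃ u v, IsCounterexample G u v ∧
      ∃ a₁ a₂ b₁ b₂ c d x, IsWitnessedCrossing G u v a₁ a₂ b₁ b₂ c d x := by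
  obtain ⟨a₁, a₂, b₁, b₂, c, d, hX⟩ := h.exists_isCrossing
  have ⟨_, hc, _⟩ := hX
  obtain ⟨x, hcx, hdx, hx⟩ := h.exists_not_adj hc (y := d) (by grind)
  rcases hx with hx | hx | hx
  · refine ⟨v, u, h.symm, ?_⟩
    by_cases hxb : x ∼ b₁
    · exact ⟨_, _, _, _, _, _, x, h.symm.isWitnessedCrossing hX.symm hx hxb hdx hcx⟩
    · exact ⟨_, _, _, _, _, _, x, h.symm.isWitnessedCrossing hX.swap.symm hx
        (by grind [h.symm.adj_iff_not_adj b₁ b₂ x]) hcx hdx⟩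
  · refine ⟨u, v, h, ?_⟩
    by_cases hxa : x ∼ a₁
    · exact ⟨_, _, _, _, _, _, x, h.isWitnessedCrossing hX hx hxa hcx hdx⟩
    · exact ⟨_, _, _, _, _, _, x, h.isWitnessedCrossing hX.swap hx
        (by grind [h.adj_iff_not_adj a₁ a₂ x]) hdx hcx⟩
  · exact absurd hdx (h.not_compl_adj_of_isCrossing a₁ a₂ b₁ b₂ c d x hX hx hcx)

theorem IsCounterexample.exists_isDoubleCrossing (h : IsCounterexample G u v)
    (hK : IsWitnessedCrossing G u v a₁ a₂ b₁ b₂ c d x) (hy : IsPrivate G v u y) (hxy : x ≁ y)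
    (hby : b₁ ∼ y) : ∃ e, IsDoubleCrossing G u v a₁ a₂ b₁ b₂ x y c d e := by
  have hya₁ : y ≁ a₁ := by grind [h.symm.adj_iff_not_adj x y a₁]
  have hya₂ : y ∼ a₂ := by grind [h.adj_iff_not_adj a₁ a₂ y]
  have hyb₂ : y ∼ b₂ := by grind [h.symm.adj_iff_not_adj b₂ y a₁]
  obtain ⟨e, he, hea₁, hey⟩ := h.exists_isCommon (a := a₁) (b := y) (by grind) hy hya₁.symm
  have hX : IsCrossing G u v a₁ a₂ x y e d :=
    h.isCrossing a₁ a₂ x y e d (by grind) he (by grind) hea₁.symm hey.symm (by grind) (by grind)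
  have hec : e ∼ c := by grind [h.not_compl_adj_of_isCrossing a₁ a₂ x y e d c]
  have hyc : y ∼ c := by grind [h.symm.adj_of_isDomino x y a₁ a₂ c]
  refine ⟨e, hK, hX, hby, ?_⟩
  by_contra heb₁
  have heb₂ : b₂ ∼ e := by
    grind [h.adj_of_isDomino a₁ a₂ b₁ b₂ e, h.symm.adj_of_isDomino b₁ b₂ a₁ a₂ e]
  grind [h.isFree.not_G17 b₂ x v y d e a₁ u a₂ b₁ c]

theorem IsCounterexample.not_isPrivate_right_of_isDoubleCrossing (h : IsCounterexample G u v)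
    (hX : IsDoubleCrossing G u v a₁ a₂ b₁ b₂ x y c d e) (hdz : d ≁ z) (hez : e ≁ z) :
    ¬ IsPrivate G v u z := by
  intro hz
  have hza₁ : z ∼ a₁ := by
    by_contra hn
    have hyz : y ∼ z := by grind [h.symm.adj_iff_not_adj y z a₁]
    have ha₂z : a₂ ∼ z := by grind [h.adj_iff_not_adj a₁ a₂ z]
    have hb₁z : b₁ ∼ z := by grind [h.symm.adj_of_isDomino z b₁ a₂ a₁ d]
    grind [h.isFree.not_G12 a₁ b₁ e v z d y a₂]
  have hb₁z : b₁ ∼ z := by grind [h.symm.adj_iff_not_adj z b₁ a₁]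
  have ha₂z : a₂ ≁ z := by grind [h.adj_iff_not_adj a₁ a₂ z]
  have hyz : y ∼ z := by grind [h.symm.adj_of_isDomino z y a₁ a₂ e]
  grind [h.isFree.not_G12 a₂ y d v z e b₁ a₁]

theorem IsCounterexample.adjacencies_of_isDoubleCrossing (h : IsCounterexample G u v)
    (hX : IsDoubleCrossing G u v a₁ a₂ b₁ b₂ x y c d e) (hz : IsPrivate G u v z) (hdz : d ≁ z)
    (hez : e ≁ z) :
    a₁ ∼ z ∧ a₂ ∼ z ∧ b₁ ∼ z ∧ b₂ ≁ z ∧ y ∼ z ∧ x ≁ z ∧ c ∼ z := by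
  have ha₁z : a₁ ∼ z := by
    by_contra hn
    have hyz : y ∼ z := by grind [h.adj_iff_not_adj z a₁ y]
    have hxz : x ≁ z := by grind [h.adj_iff_not_adj z a₁ x]
    grind [h.adj_of_isDomino z a₁ y x e]
  have ha₂z : a₂ ∼ z := by
    by_contra hn
    have hb₁z : b₁ ∼ z := by grind [h.adj_iff_not_adj z a₂ b₁]
    have hb₂z : b₂ ≁ z := by grind [h.adj_iff_not_adj z a₂ b₂]
    grind [h.adj_of_isDomino z a₂ b₁ b₂ d]
  have hb₁z : b₁ ∼ z := by
    by_contra hn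
    have hyz : y ∼ z := by grind [h.isFree.not_G2 e a₂ z b₁ y d]
    grind [h.isFree.not_G3 a₁ b₁ e z y d]
  have hb₂z : b₂ ≁ z := by grind [h.symm.adj_iff_not_adj b₁ b₂ z]
  have hyz : y ∼ z := by grind [h.isFree.not_G3 b₁ y d z a₂ e]
  have hxz : x ≁ z := by grind [h.symm.adj_iff_not_adj y x z]
  have hcz : c ∼ z := by grind [h.isFree.not_G1 d b₂ x z a₂ c]
  grind

theorem IsCounterexample.adjacencies_compl_of_isDoubleCrossing (h : IsCounterexample G u v)
    (hX : IsDoubleCrossing G u v a₁ a₂ b₁ b₂ x y c d e) (hz : IsPrivate G u v z) (hdz : d ≁ z)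
    (hez : e ≁ z) (hw : IsPrivate G u v w) (hzw : z ≁ w) :
    a₁ ∼ w ∧ a₂ ∼ w ∧ b₁ ≁ w ∧ b₂ ∼ w ∧ x ∼ w ∧ y ≁ w ∧ d ∼ w ∧ e ∼ w ∧ c ≁ w := by
  have := h.adjacencies_of_isDoubleCrossing hX hz hdz hez
  have hb₂w : b₂ ∼ w := by grind [h.adj_iff_not_adj w z b₂]
  have hxw : x ∼ w := by grind [h.adj_iff_not_adj w z x]
  have hb₁w : b₁ ≁ w := by grind [h.adj_iff_not_adj w z b₁]
  have hyw : y ≁ w := by grind [h.adj_iff_not_adj w z y]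
  have hdw : d ∼ w := by grind [h.adj_of_isDomino z w b₁ b₂ d]
  have hew : e ∼ w := by grind [h.adj_of_isDomino z w y x e]
  have ha₁w : a₁ ∼ w := by grind [h.adj_iff_not_adj w a₁ y]
  have ha₂w : a₂ ∼ w := by grind [h.adj_iff_not_adj w a₂ b₁]
  have hcw : c ≁ w := by grind [h.isFree.not_G3 w c z d v x]
  grind

theorem IsCounterexample.exists_isTripleCrossing (h : IsCounterexample G u v)
    (hX : IsDoubleCrossing G u v a₁ a₂ b₁ b₂ x y c d e) (hz : IsPrivate G u v z) (hdz : d ≁ z)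
    (hez : e ≁ z) : ∃ w f, IsTripleCrossing G u v a₁ a₂ b₁ b₂ x y w z c d e f := by
  have hz' := h.adjacencies_of_isDoubleCrossing hX hz hdz hez
  obtain ⟨w, hw, hzw⟩ := h.exists_isPrivate (x := z) (by grind)
  have hw' := h.adjacencies_compl_of_isDoubleCrossing hX hz hdz hez hw hzw
  obtain ⟨f, hf, hwf, hyf⟩ := h.exists_isCommon (a := w) (b := y) (by grind) (by grind) (by grind)
  have hX' : IsCrossing G u v w z x y f d := by grind [h.isCrossing w z x y f d]
  have hfc : f ∼ c := by grind [h.not_compl_adj_of_isCrossing w z x y f d c]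
  have hfe : f ∼ e := by grind [h.not_compl_adj_of_isCrossing w z x y f d e]
  have hfa₂ : f ∼ a₂ := by
    by_contra hn
    have hfa₁ : f ∼ a₁ := by grind [h.adj_of_isDomino a₂ a₁ y x f]
    grind [h.isFree.not_G17 a₁ z u w d f y v x a₂ e]
  have hfb₁ : f ∼ b₁ := by grind [h.isFree.not_G2 f x b₁ a₂ w d]
  exact ⟨w, f, by grind⟩

theorem IsCounterexample.not_isPrivate_left_of_isTripleCrossing (h : IsCounterexample G u v)
    (hX : IsTripleCrossing G u v a₁ a₂ b₁ b₂ x y w z c d e f) (hdg : d ≁ g) (hfg : f ≁ g) :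
    ¬ IsPrivate G u v g := by
  intro hg
  have ha₁g : a₁ ∼ g := by
    by_contra hn
    have hb₂g : b₂ ∼ g := by grind [h.adj_iff_not_adj g a₁ b₂]
    have hyg : y ∼ g := by grind [h.adj_iff_not_adj g a₁ y]
    have hb₁g : b₁ ≁ g := by grind [h.adj_iff_not_adj g a₁ b₁]
    have hxg : x ≁ g := by grind [h.adj_iff_not_adj g a₁ x]
    have heg : e ∼ g := by grind [h.adj_of_isDomino g a₁ y x e]
    have hfa₁ : f ∼ a₁ := by grind [h.adj_of_isDomino g a₁ y x f]
    have hwg : w ∼ g := by grind [h.adj_iff_not_adj g w b₂]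
    have hzg : z ∼ g := by grind [h.adj_of_isDomino z g b₁ b₂ d]
    grind [h.isFree.not_G17 w g u a₁ d e y v x z f]
  have ha₂g : a₂ ∼ g := by
    by_contra hn
    have hb₁g : b₁ ∼ g := by grind [h.adj_iff_not_adj g a₂ b₁]
    have hb₂g : b₂ ≁ g := by grind [h.adj_iff_not_adj g a₂ b₂]
    grind [h.adj_of_isDomino g a₂ b₁ b₂ d]
  have hb₁g : b₁ ∼ g := by
    by_contra hn
    have hb₂g : b₂ ∼ g := by grind [h.symm.adj_iff_not_adj b₁ b₂ g]
    have hzg : z ∼ g := by grind [h.adj_of_isDomino z g b₁ b₂ d]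
    have hyg : y ∼ g := by grind [h.isFree.not_G2 f a₂ g b₁ y d]
    have heg : e ∼ g := by grind [h.isFree.not_G3 a₁ b₁ e g y d]
    grind [h.isFree.not_G6 g a₁ d z e b₁ y]
  have hyg : y ∼ g := by grind [h.isFree.not_G3 b₁ y d g a₂ f]
  have hxg : x ≁ g := by grind [h.symm.adj_iff_not_adj y x g]
  have hwg : w ∼ g := by grind [h.adj_of_isDomino g w y x f]
  grind [h.isFree.not_G12 x w d u g f a₂ y]

theorem IsCounterexample.not_adj_of_isTripleCrossing (h : IsCounterexample G u v)
    (hX : IsTripleCrossing G u v a₁ a₂ b₁ b₂ x y w z c d e f) (hdg : d ≁ g) (hfg : f ≁ g)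
    (hg : IsPrivate G v u g) : ¬ a₁ ∼ g := by
  intro ha₁g
  have hxg : x ∼ g := by grind [h.symm.adj_iff_not_adj x y a₁, h.symm.adj_iff_not_adj g x a₁]
  have ha₂g : a₂ ≁ g := by grind [h.adj_iff_not_adj a₁ a₂ g]
  have hfa₁ : f ≁ a₁ := by grind [h.isFree.not_G3 a₁ f a₂ g v d]
  have hyg : y ∼ g := by grind [h.symm.adj_of_isDomino g y a₁ a₂ f]
  have hzg : z ∼ g := by grind [h.isFree.not_G3 a₁ z f g y d]
  have hwg : w ≁ g := by grind [h.adj_iff_not_adj z w g]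
  grind [h.isFree.not_G2 f x g a₂ w d]

theorem IsCounterexample.not_isPrivate_right_of_isTripleCrossing (h : IsCounterexample G u v)
    (hX : IsTripleCrossing G u v a₁ a₂ b₁ b₂ x y w z c d e f) (hdg : d ≁ g) (hfg : f ≁ g) :
    ¬ IsPrivate G v u g := by
  intro hg
  have ha₁g := h.not_adj_of_isTripleCrossing hX hdg hfg hg
  have hyg : y ∼ g := by grind [h.symm.adj_iff_not_adj g y a₁]
  have ha₂g : a₂ ∼ g := by grind [h.adj_iff_not_adj a₁ a₂ g]
  have hxg : x ∼ g := by grind [h.symm.adj_of_isDomino g x a₂ a₁ d]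
  have hwg : w ∼ g := by grind [h.isFree.not_G3 a₂ w d g x f]
  have hzg : z ≁ g := by grind [h.adj_iff_not_adj w z g]
  have hfa₁ : f ∼ a₁ := by grind [h.isFree.not_G2 f x g z a₁ d]
  have hcg : c ∼ g := by grind [h.isFree.not_G9 d v g x c a₁ f a₂]
  obtain ⟨k, hk, hgk⟩ := h.symm.exists_isPrivate (x := g) (by grind)
  have ha₁k : a₁ ∼ k := by grind [h.symm.adj_iff_not_adj k g a₁]
  have hzk : z ∼ k := by grind [h.symm.adj_iff_not_adj k g z]
  have ha₂k : a₂ ≁ k := by grind [h.symm.adj_iff_not_adj k g a₂]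
  have hwk : w ≁ k := by grind [h.symm.adj_iff_not_adj k g w]
  have hdk : d ∼ k := by grind [h.symm.adj_of_isDomino g k a₂ a₁ d]
  have hfk : f ∼ k := by grind [h.symm.adj_of_isDomino g k w z f]
  have hxk : x ∼ k := by grind [h.symm.adj_iff_not_adj k x a₂]
  have hyk : y ∼ k := by grind [h.symm.adj_iff_not_adj k y w]
  have hyc : y ∼ c := by grind [h.symm.adj_of_isDomino x y a₁ a₂ c]
  have hck : c ≁ k := by grind [h.isFree.not_G12 x k d y z g c u]
  grind [h.isFree.not_G17 k x v y d f w u z g c]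

theorem IsCounterexample.not_isTripleCrossing (h : IsCounterexample G u v) :
    ¬ IsTripleCrossing G u v a₁ a₂ b₁ b₂ x y w z c d e f := by
  intro hX
  obtain ⟨g, hfg, hdg, hg | hg | hg⟩ := h.exists_not_adj (x := f) (y := d) (by grind) (by grind)
  · exact h.not_isPrivate_left_of_isTripleCrossing hX hdg hfg hg
  · exact h.not_isPrivate_right_of_isTripleCrossing hX hdg hfg hg
  · grind [h.not_compl_adj_of_isCrossing w z x y f d g]

theorem IsCounterexample.not_adj_of_isWitnessedCrossing (h : IsCounterexample G u v)
    (hK : IsWitnessedCrossing G u v a₁ a₂ b₁ b₂ c d x) (hy : IsPrivate G v u y) (hxy : x ≁ y) :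
    ¬ b₁ ∼ y := by
  intro hby
  obtain ⟨e, hX⟩ := h.exists_isDoubleCrossing hK hy hxy hby
  obtain ⟨z, hez, hdz, hz | hz | hz⟩ := h.exists_not_adj (x := e) (y := d) (by grind) (by grind)
  · obtain ⟨w, f, hX'⟩ := h.exists_isTripleCrossing hX hz hdz hez
    exact h.not_isTripleCrossing hX'
  · exact h.not_isPrivate_right_of_isDoubleCrossing hX hdz hez hz
  · grind [h.not_compl_adj_of_isCrossing a₁ a₂ x y e d z]

variable (G u v) in
/-- A witnessed crossing followed by a second crossing, with the roles of `a₁` and `a₂` exchanged: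
the pair `b₁`, `b₂` moves on to `y`, `b₁` and the pair `c`, `d` to `d`, `e`. -/
abbrev IsCrossingChain (a₁ a₂ b₁ b₂ y c d e x : V) : Prop :=
  IsWitnessedCrossing G u v a₁ a₂ b₁ b₂ c d x ∧ IsCrossing G u v a₂ a₁ y b₁ d e ∧
    x ≁ y ∧ y ∼ b₂ ∧ y ∼ c ∧ x ∼ e ∧ e ∼ c

theorem IsCounterexample.exists_isCrossingChain (h : IsCounterexample G u v)
    (hK : IsWitnessedCrossing G u v a₁ a₂ b₁ b₂ c d x) :
    ∃ y e, IsCrossingChain G u v a₁ a₂ b₁ b₂ y c d e x := by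
  obtain ⟨y, hy, hxy⟩ := h.symm.exists_isPrivate (x := x) (by grind)
  have hb₁y := h.not_adj_of_isWitnessedCrossing hK hy hxy
  have ha₁y : a₁ ≁ y := by grind [h.symm.adj_iff_not_adj x y a₁]
  have ha₂y : a₂ ∼ y := by grind [h.adj_iff_not_adj a₁ a₂ y]
  obtain ⟨e, he, ha₁e, hye⟩ := h.exists_isCommon (a := a₁) (b := y) (by grind) hy ha₁y
  have hX : IsCrossing G u v a₂ a₁ y b₁ d e :=
    h.isCrossing a₂ a₁ y b₁ d e (by grind) (by grind) he (by grind) (by grind) (by grind) (by grind)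
  have hyb₂ : y ∼ b₂ := by grind [h.symm.adj_iff_not_adj b₂ y a₁, h.symm.adj_iff_not_adj b₁ y a₁]
  have hyc : y ∼ c := by grind [h.symm.adj_of_isDomino x y a₁ a₂ c]
  have hxe : x ∼ e := by grind [h.symm.adj_of_isDomino x y a₁ a₂ e]
  have hec : e ∼ c := by
    have := h.not_compl_adj_of_isCrossing a₂ a₁ y b₁ d e c hX (by grind) (by grind)
    grind
  exact ⟨y, e, hK, hX, hxy, hyb₂, hyc, hxe, hec⟩

theorem IsCounterexample.adjacencies_of_isCrossingChain (h : IsCounterexample G u v)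
    (hX : IsCrossingChain G u v a₁ a₂ b₁ b₂ y c d e x) (hz : IsPrivate G u v z) (hdz : d ≁ z)
    (hez : e ≁ z) : a₁ ∼ z ∧ a₂ ∼ z ∧ b₁ ∼ z ∧ b₂ ≁ z ∧ y ≁ z ∧ x ∼ z ∧ c ∼ z := by
  have ha₁z : a₁ ∼ z := by
    by_contra hn
    have hyz : y ∼ z := by grind [h.adj_iff_not_adj z a₁ y]
    have hb₁z : b₁ ≁ z := by grind [h.adj_iff_not_adj z a₁ b₁]
    grind [h.adj_of_isDomino z a₁ y b₁ e]
  have ha₂z : a₂ ∼ z := by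
    by_contra hn
    have hb₁z : b₁ ∼ z := by grind [h.adj_iff_not_adj z a₂ b₁]
    have hb₂z : b₂ ≁ z := by grind [h.adj_iff_not_adj z a₂ b₂]
    grind [h.adj_of_isDomino z a₂ b₁ b₂ d]
  have hb₁z : b₁ ∼ z := by
    by_contra hn
    have hb₂z : b₂ ∼ z := by grind [h.symm.adj_iff_not_adj b₁ b₂ z]
    have hyz : y ∼ z := by grind [h.symm.adj_iff_not_adj b₁ y z]
    have hxz : x ≁ z := by grind [h.symm.adj_iff_not_adj y x z]
    have hcz : c ∼ z := by grind [h.isFree.not_G3 u c b₁ z y d]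
    grind [h.isFree.not_G3 b₂ z c d a₁ x]
  have hb₂z : b₂ ≁ z := by grind [h.symm.adj_iff_not_adj b₁ b₂ z]
  have hyz : y ≁ z := by grind [h.symm.adj_iff_not_adj b₁ y z]
  have hxz : x ∼ z := by grind [h.symm.adj_iff_not_adj y x z]
  have hcz : c ∼ z := by grind [h.isFree.not_G2 x b₂ d z a₂ c]
  grind

theorem IsCounterexample.adjacencies_common_of_isCrossingChain (h : IsCounterexample G u v)
    (hX : IsCrossingChain G u v a₁ a₂ b₁ b₂ y c d e x) (hz : IsPrivate G u v z) (hdz : d ≁ z)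
    (hez : e ≁ z) (hw : IsCommon G u v w) (hzw : z ≁ w) (hb₂w : b₂ ≁ w) :
    e ∼ b₂ ∧ a₁ ∼ w ∧ b₁ ∼ w ∧ e ∼ w ∧ c ∼ w := by
  have hz' := h.adjacencies_of_isCrossingChain hX hz hdz hez
  have heb₂ : e ∼ b₂ := by grind [h.isFree.not_G3 a₂ b₂ d z x e]
  have ha₁w : a₁ ∼ w := by
    by_contra hn
    have hb₁w : b₁ ∼ w := by grind [h.symm.adj_of_isDomino b₁ b₂ a₁ a₂ w]
    have ha₂w : a₂ ∼ w := by grind [h.adj_of_isDomino a₂ a₁ b₂ b₁ w]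
    have hdw : d ≁ w := by grind [h.isFree.not_G13 b₁ w a₂ u v a₁ d b₂]
    have hxw : x ∼ w := by grind [h.isFree.not_G2 x b₂ d z a₂ w]
    grind [h.isFree.not_G3 a₂ b₂ d w x z]
  have hb₁w : b₁ ∼ w := by
    by_contra hn
    have ha₂w : a₂ ∼ w := by grind [h.symm.adj_of_isDomino b₂ b₁ a₂ a₁ w]
    have hew : e ∼ w := by grind [h.isFree.not_G2 z u w b₁ e b₂]
    have hdw : d ∼ w := by grind [h.isFree.not_G3 v w a₂ b₁ a₁ d]
    grind [h.isFree.not_G12 b₁ e b₂ a₂ w z u d]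
  have hew : e ∼ w := by grind [h.isFree.not_G3 b₁ e b₂ w u z]
  have hcw : c ∼ w := by
    by_contra hn
    have hyw : y ∼ w := by grind [h.isFree.not_G2 b₂ e w y c z]
    grind [h.isFree.not_G3 w y b₂ u c b₁]
  grind

theorem IsCounterexample.not_isPrivate_left_of_isCrossingChain (h : IsCounterexample G u v)
    (hX : IsCrossingChain G u v a₁ a₂ b₁ b₂ y c d e x) (hdz : d ≁ z) (hez : e ≁ z) :
    ¬ IsPrivate G u v z := by
  intro hz
  have hz' := h.adjacencies_of_isCrossingChain hX hz hdz hez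
  obtain ⟨w, hw, hzw, hb₂w⟩ := h.exists_isCommon (a := z) (b := b₂) (by grind) (by grind) (by grind)
  have hw' := h.adjacencies_common_of_isCrossingChain hX hz hdz hez hw hzw hb₂w
  have hdw : d ∼ w := by
    by_contra hn
    have ha₂w : a₂ ∼ w := by grind [h.isFree.not_G9 d u z a₂ w b₂ e b₁]
    have hxw : x ∼ w := by grind [h.isFree.not_G2 z a₂ w x b₂ d]
    grind [h.isFree.not_G3 a₂ b₂ d w x z]
  have ha₂w : a₂ ≁ w := by grind [h.isFree.not_G13 d w b₁ e u b₂ a₂ z]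
  have hxw : x ∼ w := by
    by_contra hn
    have hyw : y ∼ w := by grind [h.symm.adj_of_isDomino y x a₂ a₁ w]
    grind [h.isFree.not_G13 a₁ w y v u x e a₂]
  have hyw : y ≁ w := by grind [h.isFree.not_G12 y w u e b₁ b₂ x z]
  grind [h.isFree.not_G12 y c z u e d w x]

theorem IsCounterexample.not_adj_of_isCrossingChain (h : IsCounterexample G u v)
    (hX : IsCrossingChain G u v a₁ a₂ b₁ b₂ y c d e x) (hz : IsPrivate G v u z) (hdz : d ≁ z)
    (hez : e ≁ z) : ¬ a₁ ∼ z := by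
  intro ha₁z
  have ha₂z : a₂ ≁ z := by grind [h.adj_iff_not_adj a₁ a₂ z]
  have hyz : y ∼ z := by grind [h.symm.adj_of_isDomino z y a₁ a₂ e]
  have hb₂z : b₂ ∼ z := by
    by_contra hn
    have hXz : IsCrossing G u v a₁ a₂ z b₂ c d := by grind [h.isCrossing a₁ a₂ z b₂ c d]
    have hKz := h.isWitnessedCrossing (x := x) hXz (by grind) (by grind) (by grind) (by grind)
    exact h.not_adj_of_isWitnessedCrossing hKz (y := y) (by grind) (by grind) hyz.symm
  have hb₁z : b₁ ∼ z := by grind [h.symm.adj_iff_not_adj z b₁ a₂]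
  have hxz : x ∼ z := by grind [h.symm.adj_iff_not_adj x z a₂]
  have hcz : c ≁ z := by grind [h.isFree.not_G12 a₂ b₂ d v x c z a₁]
  have heb₂ : e ∼ b₂ := by grind [h.isFree.not_G12 a₂ b₂ d v z e x a₁]
  obtain ⟨w, hw, hzw⟩ := h.symm.exists_isPrivate (x := z) (by grind)
  have ha₂w : a₂ ∼ w := by grind [h.symm.adj_iff_not_adj w z a₂]
  have ha₁w : a₁ ≁ w := by grind [h.symm.adj_iff_not_adj w z a₁]
  have hew : e ∼ w := by grind [h.symm.adj_of_isDomino z w a₁ a₂ e]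
  have hdw : d ∼ w := by grind [h.symm.adj_of_isDomino w z a₂ a₁ d]
  have hKz := h.isWitnessedCrossing (x := z) hX.1.1 hz ha₁z.symm (by grind) (by grind)
  have hb₁w := h.not_adj_of_isWitnessedCrossing hKz hw hzw
  have hb₂w : b₂ ∼ w := by grind [h.symm.adj_iff_not_adj w b₂ a₁]
  grind [h.isFree.not_G10 z b₂ d w a₂ b₁ e u]

theorem IsCounterexample.exists_isCrossingChain_isWitnessedCrossing (h : IsCounterexample G u v)
    (hK : IsWitnessedCrossing G u v a₁ a₂ b₁ b₂ c d x) :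
    ∃ y e z, IsCrossingChain G u v a₁ a₂ b₁ b₂ y c d e x ∧
      IsWitnessedCrossing G u v a₂ a₁ y b₁ d e z := by
  obtain ⟨y, e, hX⟩ := h.exists_isCrossingChain hK
  obtain ⟨z, hdz, hez, hz | hz | hz⟩ := h.exists_not_adj (x := d) (y := e) (by grind) (by grind)
  · exact absurd hz (h.not_isPrivate_left_of_isCrossingChain hX hdz hez)
  · have := h.not_adj_of_isCrossingChain hX hz hdz hez
    exact ⟨y, e, z, hX, h.isWitnessedCrossing hX.2.1 hz
      (by grind [h.adj_iff_not_adj a₁ a₂ z]) hdz hez⟩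
  · grind [h.not_compl_adj_of_isCrossing a₂ a₁ y b₁ d e z]

variable (G u v) in
/-- Three witnessed crossings, with witnesses `x`, `z`, `t`, each arising from the one before by a
step of a crossing chain; `y`, `w` are the new private neighbours of `v` and `e`, `f` the new common
neighbours. -/
abbrev IsLongChain (a₁ a₂ b₁ b₂ y w c d e f x z t : V) : Prop :=
  IsCrossingChain G u v a₁ a₂ b₁ b₂ y c d e x ∧ IsCrossingChain G u v a₂ a₁ y b₁ w d e f z ∧
    IsWitnessedCrossing G u v a₁ a₂ w y e f t

variable (G u v) in
/-- A long chain with a common neighbour `g` that neither `f` nor `b₂` sees: the configuration on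
which the argument ends, as no vertex can miss both `g` and `y`. -/
abbrev IsClosedChain (a₁ a₂ b₁ b₂ y w c d e f g x z t : V) : Prop :=
  IsLongChain G u v a₁ a₂ b₁ b₂ y w c d e f x z t ∧ IsCommon G u v g ∧ f ≁ g ∧ b₂ ≁ g

theorem IsCounterexample.exists_isLongChain (h : IsCounterexample G u v)
    (hK : IsWitnessedCrossing G u v a₁ a₂ b₁ b₂ c d x) :
    ∃ y w e f z t, IsLongChain G u v a₁ a₂ b₁ b₂ y w c d e f x z t := by
  obtain ⟨y, e, z, hX, hKz⟩ := h.exists_isCrossingChain_isWitnessedCrossing hK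
  obtain ⟨w, f, t, hX', hKt⟩ := h.exists_isCrossingChain_isWitnessedCrossing hKz
  exact ⟨y, w, e, f, z, t, hX, hX', hKt⟩

theorem IsCounterexample.adjacencies_private_of_isLongChain (h : IsCounterexample G u v)
    (hL : IsLongChain G u v a₁ a₂ b₁ b₂ y w c d e f x z t) :
    z ∼ b₂ ∧ x ∼ z ∧ b₂ ∼ e ∧ x ∼ w ∧ b₂ ∼ w ∧ c ∼ z ∧ c ≁ w := by
  have hzb₂ : z ∼ b₂ := by grind [h.symm.adj_iff_not_adj b₂ z a₂]
  have hxz : x ∼ z := by grind [h.symm.adj_of_isDomino z x a₂ a₁ d]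
  have hb₂e : b₂ ∼ e := by grind [h.isFree.not_G12 a₁ x e v z d b₂ a₂]
  have hxw : x ∼ w := by grind [h.symm.adj_iff_not_adj x w a₁]
  have hb₂w : b₂ ∼ w := by grind [h.isFree.not_G3 d b₂ z w e u]
  have hcz : c ∼ z := by
    by_contra hcz
    have hKz := h.isWitnessedCrossing (x := z) hL.1.1.1.swap (by grind) (by grind)
      (by grind) (by grind)
    have := h.not_adj_of_isWitnessedCrossing hKz (y := w) (by grind) (by grind)
    grind
  have hcw : c ≁ w := by grind [h.isFree.not_G3 c w x u d y]
  grind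

theorem IsCounterexample.adjacencies_common_of_isLongChain (h : IsCounterexample G u v)
    (hL : IsLongChain G u v a₁ a₂ b₁ b₂ y w c d e f x z t) :
    b₁ ∼ f ∧ c ∼ f ∧ b₂ ≁ f := by
  have hz := h.adjacencies_private_of_isLongChain hL
  have hb₁f : b₁ ∼ f := by
    by_contra hn
    have hXf := h.isCrossing a₁ a₂ b₁ b₂ c f (by grind) (by grind) (by grind) (by grind)
      (by grind) (by grind) (by grind)
    have hKw := h.isWitnessedCrossing (x := w) hXf (by grind) (by grind) (by grind) (by grind)
    have := h.not_adj_of_isWitnessedCrossing hKw (y := z) (by grind) (by grind)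
    grind
  have hcf : c ∼ f := by grind [h.isFree.not_G3 f b₁ w u c y]
  have hb₂f : b₂ ≁ f := by grind [h.isFree.not_G12 b₁ f u d y w b₂ a₂]
  grind

theorem IsCounterexample.adjacencies_witness_of_isLongChain (h : IsCounterexample G u v)
    (hL : IsLongChain G u v a₁ a₂ b₁ b₂ y w c d e f x z t) :
    a₂ ≁ t ∧ b₁ ∼ t ∧ x ∼ t ∧ b₂ ∼ t ∧ y ∼ t ∧ z ∼ t ∧ d ∼ t ∧ x ∼ f := by
  have hz := h.adjacencies_private_of_isLongChain hL
  have hf := h.adjacencies_common_of_isLongChain hL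
  have hb₁t : b₁ ∼ t := by
    grind [h.symm.adj_iff_not_adj b₁ t a₁, h.symm.adj_of_isDomino t b₁ a₁ a₂ f]
  have hxt : x ∼ t := by grind [h.symm.adj_iff_not_adj x t a₁]
  have hb₂t : b₂ ∼ t := by grind [h.symm.adj_of_isDomino b₂ t a₂ a₁ f]
  have hzt : z ∼ t := by grind [h.symm.adj_of_isDomino t z a₁ a₂ e]
  have hdt : d ∼ t := by
    by_contra hn
    exact h.not_adj_of_isCrossingChain hL.1 (z := t) (by grind) (by grind) (by grind) (by grind)
  have hxf : x ∼ f := by grind [h.isFree.not_G12 a₂ z f v t e x a₁]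
  grind

theorem IsCounterexample.not_isPrivate_left_of_isLongChain (h : IsCounterexample G u v)
    (hL : IsLongChain G u v a₁ a₂ b₁ b₂ y w c d e f x z t) (hfg : f ≁ g) (hb₂g : b₂ ≁ g) :
    ¬ IsPrivate G u v g := by
  intro hg
  have hz := h.adjacencies_private_of_isLongChain hL
  have hf := h.adjacencies_common_of_isLongChain hL
  have ht := h.adjacencies_witness_of_isLongChain hL
  have hb₁g : b₁ ∼ g := by grind [h.symm.adj_iff_not_adj b₂ b₁ g]
  have ha₂g : a₂ ∼ g := by grind [h.adj_of_isDomino a₂ g b₂ b₁ f]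
  have hyg : y ≁ g := by grind [h.symm.adj_iff_not_adj b₁ y g]
  have hxg : x ∼ g := by grind [h.symm.adj_iff_not_adj y x g]
  have hwg : w ∼ g := by grind [h.symm.adj_iff_not_adj y w g]
  have hzg : z ≁ g := by grind [h.symm.adj_iff_not_adj z w g]
  have hdg : d ≁ g := by grind [h.isFree.not_G6 g d f w a₂ b₂ x]
  have htg : t ∼ g := by grind [h.isFree.not_G12 g x f z t a₂ b₂ d]
  grind [h.isFree.not_G13 g x f z t a₂ b₂ d]

theorem IsCounterexample.not_isPrivate_right_of_isLongChain (h : IsCounterexample G u v)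
    (hL : IsLongChain G u v a₁ a₂ b₁ b₂ y w c d e f x z t) (hfg : f ≁ g) (hb₂g : b₂ ≁ g) :
    ¬ IsPrivate G v u g := by
  intro hg
  have hf := h.adjacencies_common_of_isLongChain hL
  have ha₁g : a₁ ∼ g := by grind [h.symm.adj_iff_not_adj g b₂ a₁]
  have ha₂g : a₂ ≁ g := by grind [h.symm.adj_iff_not_adj g b₂ a₂]
  grind [h.symm.adj_of_isDomino b₂ g a₂ a₁ f]

theorem IsCounterexample.exists_isClosedChain (h : IsCounterexample G u v)
    (hL : IsLongChain G u v a₁ a₂ b₁ b₂ y w c d e f x z t) :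
    ∃ g, IsClosedChain G u v a₁ a₂ b₁ b₂ y w c d e f g x z t := by
  have hf := h.adjacencies_common_of_isLongChain hL
  obtain ⟨g, hfg, hb₂g, hg | hg | hg⟩ := h.exists_not_adj (x := f) (y := b₂) (by grind) (by grind)
  · exact absurd hg (h.not_isPrivate_left_of_isLongChain hL hfg hb₂g)
  · exact absurd hg (h.not_isPrivate_right_of_isLongChain hL hfg hb₂g)
  · exact ⟨g, hL, hg, hfg, hb₂g⟩

theorem IsCounterexample.adjacencies_of_isClosedChain (h : IsCounterexample G u v)
    (hC : IsClosedChain G u v a₁ a₂ b₁ b₂ y w c d e f g x z t) :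
    a₁ ∼ g ∧ a₂ ∼ g ∧ b₁ ∼ g ∧ y ≁ g ∧ c ∼ g ∧ d ≁ g ∧ e ∼ g ∧ w ∼ g ∧ x ∼ g ∧ z ∼ g := by
  obtain ⟨hL, hg, hfg, hb₂g⟩ := hC
  have hz := h.adjacencies_private_of_isLongChain hL
  have hf := h.adjacencies_common_of_isLongChain hL
  have ht := h.adjacencies_witness_of_isLongChain hL
  have heg : e ∼ g := by
    have := h.not_compl_adj_of_isCrossing a₂ a₁ y w f e g (by grind) hg hfg
    grind
  have ha₁g : a₁ ∼ g := by
    by_contra hn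
    have hb₁g : b₁ ∼ g := by grind [h.symm.adj_of_isDomino b₁ b₂ a₁ a₂ g]
    have hyg : y ≁ g := by grind [h.isFree.not_G3 g y b₂ b₁ f u]
    have hxg : x ∼ g := by grind [h.symm.adj_of_isDomino x y a₁ a₂ g]
    grind [h.isFree.not_G10 b₂ x g b₁ a₁ y f u]
  have ha₂g : a₂ ∼ g := by
    by_contra hn
    have hxg : x ∼ g := by
      by_contra hn
      have hX := h.isCrossing a₂ a₁ y x g e (by grind) hg (by grind) (by grind) (by grind)
        (by grind) (by grind)
      grind [h.not_compl_adj_of_isCrossing a₂ a₁ y x g e f]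
    have hdg : d ∼ g := by grind [h.isFree.not_G2 f x g d b₂ a₂]
    grind [h.isFree.not_G3 d b₂ a₂ g x f]
  have hcg : c ∼ g := by grind [h.isFree.not_G3 a₂ g a₁ b₂ v c]
  have hwg : w ∼ g := by grind [h.isFree.not_G3 v g a₂ w a₁ f]
  have htg : t ∼ g := by grind [h.isFree.not_G3 v g a₂ f a₁ t]
  have hb₁g : b₁ ∼ g := by grind [h.isFree.not_G3 t b₁ f g e b₂]
  have hyg : y ≁ g := by grind [h.isFree.not_G3 g y b₂ b₁ f u]
  have hdg : d ≁ g := by grind [h.isFree.not_G6 g d b₂ a₁ c f x, h.isFree.not_G13 g d f y t a₂ b₂ x]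
  have hxg : x ∼ g := by grind [h.isFree.not_G2 g w x u d y]
  have hzg : z ∼ g := by grind [h.isFree.not_G12 d v z b₁ e a₁ g a₂]
  grind

theorem IsCounterexample.not_isPrivate_left_of_isClosedChain (h : IsCounterexample G u v)
    (hC : IsClosedChain G u v a₁ a₂ b₁ b₂ y w c d e f g x z t) (hgk : g ≁ k) (hyk : y ≁ k) :
    ¬ IsPrivate G u v k := by
  intro hk
  have hg' := h.adjacencies_of_isClosedChain hC
  obtain ⟨hL, hg, hfg, hb₂g⟩ := hC
  have hf := h.adjacencies_common_of_isLongChain hL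
  have ht := h.adjacencies_witness_of_isLongChain hL
  have hb₁k : b₁ ∼ k := by grind [h.symm.adj_iff_not_adj y b₁ k]
  have hxk : x ∼ k := by grind [h.symm.adj_iff_not_adj y x k]
  have hb₂k : b₂ ≁ k := by grind [h.symm.adj_iff_not_adj b₁ b₂ k]
  have hfk : f ∼ k := by grind [h.isFree.not_G3 u f y k b₁ g]
  grind [h.isFree.not_G10 y f u k b₁ b₂ x g]

theorem IsCounterexample.not_isPrivate_right_of_isClosedChain (h : IsCounterexample G u v)
    (hC : IsClosedChain G u v a₁ a₂ b₁ b₂ y w c d e f g x z t) (hgk : g ≁ k) (hyk : y ≁ k) :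
    ¬ IsPrivate G v u k := by
  intro hk
  have hg' := h.adjacencies_of_isClosedChain hC
  obtain ⟨hL, hg, hfg, hb₂g⟩ := hC
  have hz := h.adjacencies_private_of_isLongChain hL
  have hf := h.adjacencies_common_of_isLongChain hL
  have ha₁k : a₁ ∼ k := by grind [h.symm.adj_iff_not_adj k y a₁]
  have hb₁k : b₁ ∼ k := by grind [h.symm.adj_iff_not_adj k b₁ a₁, h.symm.adj_iff_not_adj k b₁ a₂]
  have hwk : w ∼ k := by grind [h.symm.adj_iff_not_adj k w a₁, h.symm.adj_iff_not_adj k w a₂]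
  have hzk : z ≁ k := by grind [h.isFree.not_G2 k z y w g u]
  have hfk : f ∼ k := by grind [h.isFree.not_G2 g b₁ k u f y]
  have hb₂k : b₂ ∼ k := by grind [h.isFree.not_G2 u f k g z b₂]
  grind [h.isFree.not_G9 u f k b₁ y g z b₂]

theorem IsCounterexample.not_isCommon_of_isClosedChain (h : IsCounterexample G u v)
    (hC : IsClosedChain G u v a₁ a₂ b₁ b₂ y w c d e f g x z t) (hgk : g ≁ k) (hyk : y ≁ k) :
    ¬ IsCommon G u v k := by
  intro hk
  have hg' := h.adjacencies_of_isClosedChain hC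
  obtain ⟨hL, hg, hfg, hb₂g⟩ := hC
  have hf := h.adjacencies_common_of_isLongChain hL
  have ht := h.adjacencies_witness_of_isLongChain hL
  have ha₁k : a₁ ∼ k := by
    by_contra hn
    have := h.not_compl_adj_of_isCrossing a₁ a₂ b₁ y k d g
    grind [h.isCrossing a₁ a₂ b₁ y k d]
  have ha₂k : a₂ ∼ k := by
    by_contra hn
    have hb₁k : b₁ ∼ k := by grind [h.symm.adj_of_isDomino y b₁ a₂ a₁ k]
    have hxk : x ∼ k := by grind [h.symm.adj_of_isDomino y x a₂ a₁ k]
    have hfk : f ∼ k := by grind [h.isFree.not_G3 v g a₂ k a₁ f]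
    have hb₂k : b₂ ∼ k := by grind [h.isFree.not_G10 b₂ x g b₁ k y f u]
    grind [h.isFree.not_G12 y f u k b₁ b₂ x g]
  have hek : e ∼ k := by grind [h.isFree.not_G3 a₂ k a₁ y v e]
  grind [h.isFree.not_G6 k a₂ y e a₁ g v]

theorem IsCounterexample.not_isClosedChain (h : IsCounterexample G u v) :
    ¬ IsClosedChain G u v a₁ a₂ b₁ b₂ y w c d e f g x z t := by
  intro hC
  obtain ⟨-, -, -, hyg, -⟩ := h.adjacencies_of_isClosedChain hC
  obtain ⟨k, hgk, hyk, hk | hk | hk⟩ :=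
    h.exists_not_adj (x := g) (y := y) hC.2.1 ((G.compl_adj g y).1 hyg.symm).2
  · exact h.not_isPrivate_left_of_isClosedChain hC hgk hyk hk
  · exact h.not_isPrivate_right_of_isClosedChain hC hgk hyk hk
  · exact h.not_isCommon_of_isClosedChain hC hgk hyk hk

theorem not_isCounterexample : ¬ IsCounterexample G u v := by
  intro h
  obtain ⟨u, v, h, _, _, _, _, _, _, _, hK⟩ := h.exists_isWitnessedCrossing
  obtain ⟨_, _, _, _, _, _, hL⟩ := h.exists_isLongChain hK
  obtain ⟨_, hC⟩ := h.exists_isClosedChain hL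
  exact h.not_isClosedChain hC

end DomPerfect

theorem theorem9 {V : Type*} [Finite V] (G : SimpleGraph V) :
    DomPerfect.IsDominationPerfect G ↔
      ∀ j : Fin 17, ¬ (DomPerfect.forbidden j).2.IsIndContained G := by
  constructor
  · intro hG j hj
    obtain ⟨u, v, huv⟩ := DomPerfect.exists_isDominatingEdge_forbidden j
    exact hG.not_isDominatingEdge hj (DomPerfect.forbidden_noIndepDominatingPair j) u v huv
  · intro hG S
    by_contra hne
    obtain ⟨T, u, v, hpair, huv⟩ :=
      DomPerfect.exists_isDominatingEdge_of_dominationNumber_ne hne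
    have hfree : DomPerfect.IsFree ((G.induce S).induce T) :=
      DomPerfect.IsFree.of_isIndContained hG
        (SimpleGraph.IsIndContained.trans ⟨SimpleGraph.Embedding.induce T⟩
          ⟨SimpleGraph.Embedding.induce S⟩)
    exact DomPerfect.not_isCounterexample ⟨hfree, hpair, huv⟩
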